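/- Notation. Write $\mathbb H$ for the real quaternions, with conjugate $h^*$ and norm $\|h\|$; a quaternion is pure if its real part is $0$. Dual quaternions are $\underline h=h+\varepsilon h'$ with $h,h'\in\mathbb H$ and $\varepsilon^2=0$, $\underline h^*=h^*+\varepsilon h'^*$, and $\underline h$ is a unit dual quaternion if $\underline h\,\underline h^*=1$. A unit dual quaternion (a pose) is uniquely $x=r+\tfrac12\varepsilon\,p\,r$ with $\|r\|=1$ (rotation) and $p$ pure (translation). If $r\neq-1$, write $r=\cos(\phi/2)+\sin(\phi/2)\,\mathbf n$ with $\phi\in[0,2\pi)$ and $\mathbf n$ a pure quaternion of norm one, and set $\log r=\tfrac{\phi}{2}\mathbf n$, $\log x=\tfrac12(\phi\,\mathbf n+\varepsilon p)$. Let $\mathrm{vec}_4$, $\mathrm{vec}_8$ be the coordinate maps of quaternions and dual quaternions, and $\mathrm{vec}_3$, $\mathrm{vec}_6$ those of pure quaternions and of dual quaternions with pure parts. Let $H^{+}_4(h),H^-_4(h)$ be the matrices of left and right multiplication by $h\in\mathbb H$, $H^-_8(\underline h)=\begin{bmatrix}H_4^-(h)&0\\H_4^-(h')&H_4^-(h)\end{bmatrix}$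 that of right multiplication by $\underline h$, $Q_p=\begin{bmatrix}0_{1\times3}\\I_3\end{bmatrix}$, $Q(r)=\partial\,\mathrm{vec}_4 r/\partial\,\mathrm{vec}_3 y\in\mathbb R^{4\times 3}$ the Jacobian of $y\mapsto \exp y$ (on pure quaternions) at $y=\log r$, and $$Q_8(x)=\begin{bmatrix}Q(r)&0_{4\times3}\\ \tfrac12H_4^+(p)Q(r)&H_4^-(r)Q_p\end{bmatrix}\in\mathbb R^{8\times6}.$$ Let $n\ge1$ and let $\mathcal G$ be a simple weighted directed graph on $n$ vertices, with weights $a_{ij}>0$ if there is an edge from $j$ to $i$ and $a_{ij}=0$ otherwise ($a_{ii}=0$). $\mathcal G$ has a directed spanning tree if removing some edges leaves a directed graph on all the vertices with a root that has no parent, in which every other vertex has exactly one parent and can be reached from the root by a directed path. Statement (pose consensus with twist inputs). Consider $n$ agents with poses $x_i(t)=r_i+\tfrac12\varepsilon\,p_ir_i$, $t\ge0$, and kinematics $\dot x_i=\tfrac12\xi_ix_i$, where $\xi_i=\omega_i+\varepsilon(\dot p_i+p_i\times\omega_i)$ is the twist of agent $i$ ($\omega_i$ pure, $p\times\omega=\tfrac12(p\omega-\omega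 p)$). Let the twists be the inputs, let $y_i=\log x_i$, and apply the protocol $$\mathrm{vec}_8\,\xi_i=-2\,H^-_8(x_i^*)\,Q_8(x_i)\sum_{j=1}^na_{ij}\,\mathrm{vec}_6(y_i-y_j),\qquad i=1,\dots,n.$$ Then: 1. For all initial poses with $r_i(0)\ne-1$ for every $i$, the closed loop has a trajectory on $[0,\infty)$ with these initial poses and with $r_i(t)\neq-1$ for all $i$ and all $t\ge0$. 2. $\mathcal G$ has a directed spanning tree if and only if every trajectory on $[0,\infty)$ of the closed loop with $r_i(0)\neq-1$ for every $i$ achieves output consensus: $y_i(t)-y_j(t)\to0$ as $t\to\infty$ for all $i,j$. 3. $\mathcal G$ has a directed spanning tree if and only if every such trajectory achieves pose consensus: there is a unit dual quaternion $c$ with $x_i(t)\to c$ as $t\to\infty$ for all $i$. -/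

import Mathlib

open Filter Topology
open scoped Quaternion Matrix

noncomputable section

namespace PoseConsensus

/-! ### Weighted directed graphs -/

/-- A simple weighted directed graph on the vertices `0, …, n-1`.  `Adj j i` says that there is an
edge with tail (parent) `j` and head (child) `i`; its weight is `weight i j`. -/
structure WeightedDigraph (n : ℕ) extends Digraph (Fin n) where
  loopless : ∀ i, ¬ Adj i i
  weight : Matrix (Fin n) (Fin n) ℝ
  weight_pos : ∀ i j, Adj j i → 0 < weight i j
  weight_eq_zero : ∀ i j, ¬ Adj j i → weight i j = 0

/-- A directed tree with root `r`: the root has no parent, every other vertex has exactly one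
parent, and every vertex is reached from the root by a directed path. -/
def IsDirectedTree {V : Type*} (T : Digraph V) (r : V) : Prop :=
  (∀ u, ¬ T.Adj u r) ∧ (∀ v, v ≠ r → ∃! u, T.Adj u v) ∧ ∀ v, Relation.ReflTransGen T.Adj r v

/-- Some directed tree on all the vertices is obtained by removing edges of `G`. -/
def HasDirectedSpanningTree {V : Type*} (G : Digraph V) : Prop :=
  ∃ (T : Digraph V) (r : V), (∀ u v, T.Adj u v → G.Adj u v) ∧ IsDirectedTree T r

/-! ### Dual quaternions -/

/-- Dual quaternions `h + ε h'`, with `h = fst` and `h' = snd` (Mathlib's dual numbers over `ℍ`). -/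
abbrev DQ : Type := DualNumber ℍ[ℝ]

/-- The dual quaternion `h + ε h'`. -/
def mkDQ (h h' : ℍ[ℝ]) : DQ := TrivSqZeroExt.inl h + TrivSqZeroExt.inr h'

/-- The conjugate `h* + ε h'*`. -/
def conj (x : DQ) : DQ := mkDQ (star x.fst) (star x.snd)

/-- Unit dual quaternions: `‖x‖ = √(x x*) = 1`, that is `x x* = 1`. -/
def IsUnitDQ (x : DQ) : Prop := x * conj x = 1

/-- The translation `p` of the pose `x = r + ε (1/2) p r` (with `r` a unit quaternion). -/
def translation (x : DQ) : ℍ[ℝ] := (2 : ℝ) • (x.snd * star x.fst)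

/-- The rotation angle `φ ∈ [0, 2π]` of a unit quaternion `r = cos (φ/2) + sin (φ/2) n`;
`φ = 2π` happens only for `r = -1`. -/
def rotAngle (r : ℍ[ℝ]) : ℝ := 2 * Real.arccos r.re

/-- The rotation axis `n` of a unit quaternion `r = cos (φ/2) + sin (φ/2) n`
(it is `0` when `r = ±1`). -/
def rotAxis (r : ℍ[ℝ]) : ℍ[ℝ] := ‖r.im‖⁻¹ • r.im

/-- `log r = (φ/2) n` for a unit quaternion `r ≠ -1`. -/
def logQ (r : ℍ[ℝ]) : ℍ[ℝ] := (rotAngle r / 2) • rotAxis r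

/-- `log x = (1/2) (φ n + ε p)` for a unit dual quaternion `x = r + ε (1/2) p r` with `r ≠ -1`. -/
def logDQ (x : DQ) : DQ :=
  (1 / 2 : ℝ) • mkDQ (rotAngle x.fst • rotAxis x.fst) (translation x)

/-- The polar form `r = cos (φ/2) + sin (φ/2) n`, with `φ ∈ [0, 2π)`, that the logarithm reads off:
the axis is pure and of norm one unless `r = 1`. -/
theorem polar_form (r : ℍ[ℝ]) (hr : ‖r‖ = 1) (h1 : r ≠ -1) :
    r = ((Real.cos (rotAngle r / 2) : ℝ) : ℍ[ℝ]) + Real.sin (rotAngle r / 2) • rotAxis r ∧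
      rotAngle r ∈ Set.Ico 0 (2 * Real.pi) ∧ (rotAxis r).re = 0 ∧ (r ≠ 1 → ‖rotAxis r‖ = 1) := by
  have hsq : r.re ^ 2 + ‖r.im‖ ^ 2 = 1 := by
    have e1 : Quaternion.normSq r = 1 := by rw [Quaternion.normSq_eq_norm_mul_self, hr, one_mul]
    have e2 : Quaternion.normSq r.im = ‖r.im‖ ^ 2 := by
      rw [Quaternion.normSq_eq_norm_mul_self, sq]
    rw [Quaternion.normSq_def'] at e1 e2
    simp at e2
    linarith
  have hlo : -1 ≤ r.re := by nlinarith [sq_nonneg ‖r.im‖]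
  have hhi : r.re ≤ 1 := by nlinarith [sq_nonneg ‖r.im‖]
  have hhalf : rotAngle r / 2 = Real.arccos r.re := by unfold rotAngle; ring
  have hsin : Real.sin (rotAngle r / 2) = ‖r.im‖ := by
    rw [hhalf, Real.sin_arccos, show 1 - r.re ^ 2 = ‖r.im‖ ^ 2 by linarith,
      Real.sqrt_sq (norm_nonneg _)]
  have him : r.im = 0 → r = (r.re : ℍ[ℝ]) := fun h => by
    conv_lhs => rw [← Quaternion.re_add_im r, h, add_zero]
  refine ⟨?_, ⟨?_, ?_⟩, ?_, ?_⟩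
  · rw [hsin, hhalf, Real.cos_arccos hlo hhi, rotAxis, smul_smul]
    by_cases h : r.im = 0
    · simpa [h] using him h
    · rw [mul_inv_cancel₀ (norm_ne_zero_iff.2 h), one_smul, Quaternion.re_add_im]
  · unfold rotAngle; linarith [Real.arccos_nonneg r.re]
  · have hne : -1 < r.re := by
      refine lt_of_le_of_ne hlo fun h => h1 ?_
      have h0 : r.im = 0 := by
        rw [← norm_eq_zero]; rw [← h] at hsq; nlinarith [norm_nonneg r.im]
      rw [him h0, ← h]; simp
    have hlt : Real.arccos r.re < Real.pi :=
      lt_of_le_of_ne (Real.arccos_le_pi _) fun h => absurd (Real.arccos_eq_pi.1 h) (by linarith)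
    unfold rotAngle; linarith
  · simp [rotAxis]
  · intro hne
    have h0 : r.im ≠ 0 := by
      intro h
      have h2 : r.re ^ 2 = 1 := by rw [h] at hsq; simpa using hsq
      rcases mul_self_eq_one_iff.1 (by rw [← sq]; exact h2 : r.re * r.re = 1) with h3 | h3
      · exact hne (by rw [him h, h3]; simp)
      · exact h1 (by rw [him h, h3]; simp)
    rw [rotAxis, norm_smul, norm_inv, norm_norm, inv_mul_cancel₀ (norm_ne_zero_iff.2 h0)]

/-- The cross product `(p w - w p) / 2` of pure quaternions. -/
def cross (p w : ℍ[ℝ]) : ℍ[ℝ] := (1 / 2 : ℝ) • (p * w - w * p)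

/-- The twist `ω + ε (v + p × ω)` of a frame with position `p`, angular velocity `ω` and linear
velocity `v`, expressed in the inertial frame. -/
def twist (p ω v : ℍ[ℝ]) : DQ := mkDQ ω (v + cross p ω)

/-! ### Coordinates and Hamilton operators

`ℝ⁶` and `ℝ⁸` are indexed by `Fin 3 ⊕ Fin 3` and `Fin 4 ⊕ Fin 4` (primary part, then dual part). -/

def vec3 (h : ℍ[ℝ]) : Fin 3 → ℝ := ![h.imI, h.imJ, h.imK]

def vec4 (h : ℍ[ℝ]) : Fin 4 → ℝ := ![h.re, h.imI, h.imJ, h.imK]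

def vec6 (x : DQ) : Fin 3 ⊕ Fin 3 → ℝ := Sum.elim (vec3 x.fst) (vec3 x.snd)

def vec8 (x : DQ) : Fin 4 ⊕ Fin 4 → ℝ := Sum.elim (vec4 x.fst) (vec4 x.snd)

/-- The pure quaternion with `vec3 = v`. -/
def pureQ (v : Fin 3 → ℝ) : ℍ[ℝ] := ⟨0, v 0, v 1, v 2⟩

def hamiPlus4 (h : ℍ[ℝ]) : Matrix (Fin 4) (Fin 4) ℝ :=
  !![h.re, -h.imI, -h.imJ, -h.imK;
     h.imI, h.re, -h.imK, h.imJ;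
     h.imJ, h.imK, h.re, -h.imI;
     h.imK, -h.imJ, h.imI, h.re]

def hamiMinus4 (h : ℍ[ℝ]) : Matrix (Fin 4) (Fin 4) ℝ :=
  !![h.re, -h.imI, -h.imJ, -h.imK;
     h.imI, h.re, h.imK, -h.imJ;
     h.imJ, -h.imK, h.re, h.imI;
     h.imK, h.imJ, -h.imI, h.re]

def hamiMinus8 (x : DQ) : Matrix (Fin 4 ⊕ Fin 4) (Fin 4 ⊕ Fin 4) ℝ :=
  Matrix.fromBlocks (hamiMinus4 x.fst) 0 (hamiMinus4 x.snd) (hamiMinus4 x.fst)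

/-! ### The differential of the logarithmic coordinates -/

/-- `Q(r) = ∂ vec₄ r / ∂ vec₃ y` at `y = log r`: the Jacobian matrix of `y ↦ vec₄ (exp y)` on pure
quaternions. -/
def Q (r : ℍ[ℝ]) : Matrix (Fin 4) (Fin 3) ℝ :=
  Matrix.of fun i j =>
    fderiv ℝ (fun v : Fin 3 → ℝ => vec4 (NormedSpace.exp (pureQ v))) (vec3 (logQ r))
      (Pi.single j 1) i

/-- The `4 × 3` matrix with a zero first row above the identity. -/
def Qp : Matrix (Fin 4) (Fin 3) ℝ :=
  !![0, 0, 0;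
     1, 0, 0;
     0, 1, 0;
     0, 0, 1]

/-- The `8 × 6` matrix `Q₈(x)` with `vec₈ ẋ = Q₈(x) vec₆ ẏ` for `y = log x`. -/
def Q8 (x : DQ) : Matrix (Fin 4 ⊕ Fin 4) (Fin 3 ⊕ Fin 3) ℝ :=
  Matrix.fromBlocks (Q x.fst) 0
    ((1 / 2 : ℝ) • (hamiPlus4 (translation x) * Q x.fst)) (hamiMinus4 x.fst * Qp)

/-! ### The multi-agent system -/

/-- A rigid body with pose `x t` and twist `ξ t` for `t ≥ 0`: `x t` is a unit dual quaternion,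
`ẋ = (1/2) ξ x`, and `ξ t` is the twist of the position `p = translation (x t)`, its derivative and
a (pure) angular velocity. -/
structure IsRigidMotion (x ξ : ℝ → DQ) : Prop where
  unit : ∀ t, 0 ≤ t → IsUnitDQ (x t)
  kinematics : ∀ t, 0 ≤ t →
    HasDerivWithinAt x ((1 / 2 : ℝ) • (ξ t * x t)) (Set.Ici 0) t
  isTwist : ∀ t, 0 ≤ t → ∃ ω v : ℍ[ℝ], ω.re = 0 ∧
    HasDerivWithinAt (fun s => translation (x s)) v (Set.Ici 0) t ∧
    ξ t = twist (translation (x t)) ω v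

/-- The value that the protocol prescribes for `vec₈ ξᵢ` when the poses are `x`:
`-2 H⁻₈(xᵢ*) Q₈(xᵢ) ∑ⱼ aᵢⱼ vec₆ (yᵢ - yⱼ)`, with `yᵢ = log xᵢ`. -/
def twistProtocol {n : ℕ} (G : WeightedDigraph n) (x : Fin n → DQ) (i : Fin n) :
    Fin 4 ⊕ Fin 4 → ℝ :=
  (-2 : ℝ) • ((hamiMinus8 (conj (x i)) * Q8 (x i)) *ᵥ
    ∑ j, G.weight i j • vec6 (logDQ (x i) - logDQ (x j)))

/-- Configurations of poses at which all the logarithms are defined: every rotation has an angle in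
`[0, 2π)`, that is, differs from `-1`. -/
def Admissible {n : ℕ} (x : Fin n → DQ) : Prop :=
  ∀ i, IsUnitDQ (x i) ∧ (x i).fst ≠ -1

/-- `x` is a trajectory on `[0, ∞)` of the closed loop formed by the agents and the protocol,
started at an admissible configuration. -/
structure IsClosedLoop {n : ℕ} (G : WeightedDigraph n) (x : Fin n → ℝ → DQ) : Prop where
  init : Admissible fun i => x i 0
  motion : ∃ ξ : Fin n → ℝ → DQ, ∀ i, IsRigidMotion (x i) (ξ i) ∧
    ∀ t, 0 ≤ t → vec8 (ξ i t) = twistProtocol G (fun j => x j t) i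

/-- Output consensus: all the differences `yᵢ - yⱼ` of the outputs `yᵢ = log xᵢ` tend to `0`. -/
def AchievesOutputConsensus {n : ℕ} (x : Fin n → ℝ → DQ) : Prop :=
  ∀ i j, Tendsto (fun t => logDQ (x i t) - logDQ (x j t)) atTop (𝓝 0)

/-- Pose consensus: all the poses tend to one common pose. -/
def AchievesPoseConsensus {n : ℕ} (x : Fin n → ℝ → DQ) : Prop :=
  ∃ c : DQ, IsUnitDQ c ∧ ∀ i, Tendsto (x i) atTop (𝓝 c)

end PoseConsensus

end

/-! In logarithmic coordinates the closed loop is linear. Write `L` for the Laplacian of the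
weights. The factors `-2` and `H⁻₈(xᵢ*)` undo the kinematics `ẋ = ½ ξ x`, and `Q₈` is the
differential of the inverse of `log`, so every admissible trajectory satisfies `ẏ = -L y`. For the
rotations, `exp` is an immersion of the ball of pure quaternions of norm less than `π`, which
transfers differentiability and the velocity from `r` to `log r`. For the translations, the twist
form of `ξ` determines `ṗ`. Hence `y(t) = exp(-tL) y(0)`.

The matrix `exp(-tL)` is nonnegative with row sums one, so it maps every ball of radius `R < π` to
itself. Applied to the rotation logarithms, this gives existence, and it shows that no trajectory
reaches the rotation `-1`.

If some vertex reaches all the others, its column of `exp(-L)` is positive. Each unit of time then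
shrinks the spread of every column by a fixed factor, the flow converges to a matrix with equal
rows, and logarithms and poses converge to common limits (`exists_tendsto_consensusFlow`). Without a
spanning tree, two vertices have no common ancestor. Each evolves from its own ancestors alone, so
suitable pure translations keep the two agents apart forever (`exists_constant_gap`). -/

noncomputable section

namespace PoseConsensus

/-! ### The consensus semigroup of a weight matrix -/

section Flow

attribute [local instance] Matrix.linftyOpNormedRing Matrix.linftyOpNormedAlgebra

variable {n : ℕ}

/-- The negative of the Laplacian of a weight matrix. -/
def negLaplacian (w : Matrix (Fin n) (Fin n) ℝ) : Matrix (Fin n) (Fin n) ℝ :=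
  w - Matrix.diagonal fun i => ∑ j, w i j

/-- The consensus semigroup `exp (-t L)`. -/
def consensusFlow (w : Matrix (Fin n) (Fin n) ℝ) (t : ℝ) : Matrix (Fin n) (Fin n) ℝ :=
  NormedSpace.exp (t • negLaplacian w)

theorem sum_negLaplacian_smul {V : Type*} [AddCommGroup V] [Module ℝ V]
    (w : Matrix (Fin n) (Fin n) ℝ) (y : Fin n → V) (i : Fin n) :
    ∑ j, negLaplacian w i j • y j = -∑ j, w i j • (y i - y j) := by
  simp [negLaplacian, sub_smul, smul_sub, Matrix.diagonal_apply, ite_smul, Finset.sum_smul]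

theorem hasDerivAt_consensusFlow (w : Matrix (Fin n) (Fin n) ℝ) (t : ℝ) (i j : Fin n) :
    HasDerivAt (fun s => consensusFlow w s i j) ((negLaplacian w * consensusFlow w t) i j) t := by
  have h := hasDerivAt_exp_smul_const' (𝕂 := ℝ) (negLaplacian w) t
  let e : Matrix (Fin n) (Fin n) ℝ →L[ℝ] ℝ := LinearMap.toContinuousLinearMap
    { toFun := fun A => A i j, map_add' := fun _ _ => rfl, map_smul' := fun _ _ => rfl }
  exact e.hasFDerivAt.comp_hasDerivAt t h

theorem commute_consensusFlow (w : Matrix (Fin n) (Fin n) ℝ) (t : ℝ) :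
    negLaplacian w * consensusFlow w t = consensusFlow w t * negLaplacian w :=
  (((Commute.refl (negLaplacian w)).smul_right t).exp_right).eq

theorem consensusFlow_zero (w : Matrix (Fin n) (Fin n) ℝ) : consensusFlow w 0 = 1 := by
  simp [consensusFlow]

theorem consensusFlow_add (w : Matrix (Fin n) (Fin n) ℝ) (s t : ℝ) :
    consensusFlow w (s + t) = consensusFlow w s * consensusFlow w t := by
  rw [consensusFlow, add_smul]
  exact Matrix.exp_add_of_commute _ _ (((Commute.refl _).smul_right t).smul_left s)

theorem hasSum_exp_apply (A : Matrix (Fin n) (Fin n) ℝ) (i j : Fin n) :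
    HasSum (fun k : ℕ => ((k.factorial : ℝ)⁻¹ • A ^ k) i j) (NormedSpace.exp A i j) := by
  have h : HasSum (fun k : ℕ => (k.factorial : ℝ)⁻¹ • A ^ k) (NormedSpace.exp A) :=
    NormedSpace.exp_series_hasSum_exp' (𝕂 := ℝ) A
  exact Pi.hasSum.1 (Pi.hasSum.1 h i) j

theorem pow_apply_nonneg {A : Matrix (Fin n) (Fin n) ℝ} (hA : ∀ i j, 0 ≤ A i j) (k : ℕ) :
    ∀ i j, 0 ≤ (A ^ k) i j := by
  induction k with
  | zero => intro i j; rw [pow_zero, Matrix.one_apply]; split_ifs <;> norm_num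
  | succ k ih =>
    intro i j
    rw [pow_succ, Matrix.mul_apply]
    exact Finset.sum_nonneg fun l _ => mul_nonneg (ih i l) (hA l j)

theorem exp_apply_nonneg {A : Matrix (Fin n) (Fin n) ℝ} (hA : ∀ i j, 0 ≤ A i j) (i j : Fin n) :
    0 ≤ NormedSpace.exp A i j :=
  (hasSum_exp_apply A i j).nonneg fun k =>
    mul_nonneg (by positivity) (pow_apply_nonneg hA k i j)

/-- A nonnegative matrix has exponential with positive entries along its paths. -/
theorem exp_apply_pos {A : Matrix (Fin n) (Fin n) ℝ} (hA : ∀ i j, 0 ≤ A i j) {r i : Fin n}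
    (h : Relation.ReflTransGen (fun j i => 0 < A i j) r i) : 0 < NormedSpace.exp A i r := by
  have hk : ∃ k : ℕ, 0 < (A ^ k) i r := by
    induction h with
    | refl => exact ⟨0, by simp⟩
    | @tail b c _ hbc ih =>
      obtain ⟨k, hk⟩ := ih
      refine ⟨k + 1, ?_⟩
      rw [pow_succ', Matrix.mul_apply]
      exact Finset.sum_pos' (fun l _ => mul_nonneg (hA c l) (pow_apply_nonneg hA k l r))
        ⟨b, Finset.mem_univ b, mul_pos hbc hk⟩
  obtain ⟨k, hk⟩ := hk
  have h1 := (hasSum_exp_apply A i r)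
  have h2 : 0 < ((k.factorial : ℝ)⁻¹ • A ^ k) i r := mul_pos (by positivity) hk
  exact h2.trans_le (le_hasSum h1 k fun m _ =>
    mul_nonneg (by positivity) (pow_apply_nonneg hA m i r))

/-- The nonnegative matrix `w + d - diag (rowsum)` whose exponential is `exp d` times the flow. -/
theorem consensusFlow_eq (w : Matrix (Fin n) (Fin n) ℝ) (t d : ℝ) :
    consensusFlow w t = Real.exp (-(t * d)) •
      NormedSpace.exp (t • (negLaplacian w + d • (1 : Matrix (Fin n) (Fin n) ℝ))) := by
  have h : t • negLaplacian w = t • (negLaplacian w + d • (1 : Matrix (Fin n) (Fin n) ℝ)) +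
      algebraMap ℝ _ (-(t * d)) := by
    rw [Algebra.algebraMap_eq_smul_one, smul_add, smul_smul]; module
  have h2 : NormedSpace.exp (algebraMap ℝ (Matrix (Fin n) (Fin n) ℝ) (-(t * d))) =
      algebraMap ℝ _ (NormedSpace.exp (-(t * d))) := (NormedSpace.algebraMap_exp_comm _).symm
  rw [consensusFlow, h, Matrix.exp_add_of_commute _ _ (Algebra.commute_algebraMap_right _ _), h2,
    ← Algebra.commutes, Algebra.algebraMap_eq_smul_one, smul_mul_assoc, one_mul,
    Real.exp_eq_exp_ℝ]

/-- Adding a large multiple of the identity makes the generator nonnegative and costs only a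
positive scalar factor in the exponential, so sign statements about `exp` of nonnegative matrices
pass to the flow. -/
theorem exists_shift_nonneg {w : Matrix (Fin n) (Fin n) ℝ} (hw : ∀ i j, 0 ≤ w i j) :
    ∃ d : ℝ, ∀ i j, w i j ≤ (negLaplacian w + d • (1 : Matrix (Fin n) (Fin n) ℝ)) i j := by
  -- The total weight bounds every row sum, which is what the diagonal of `negLaplacian w`
  -- subtracts.
  refine ⟨∑ i, ∑ j, w i j, fun i j => ?_⟩
  by_cases h : i = j
  · subst h
    have := Finset.single_le_sum (f := fun i => ∑ j, w i j)
      (fun i _ => Finset.sum_nonneg fun j _ => hw i j) (Finset.mem_univ i)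
    simp only [negLaplacian, Matrix.add_apply, Matrix.sub_apply, Matrix.diagonal_apply_eq,
      Matrix.smul_apply, Matrix.one_apply_eq, smul_eq_mul, mul_one]
    linarith
  · simp [negLaplacian, Matrix.diagonal_apply_ne _ h, Matrix.one_apply_ne h]

theorem consensusFlow_nonneg {w : Matrix (Fin n) (Fin n) ℝ} (hw : ∀ i j, 0 ≤ w i j) {t : ℝ}
    (ht : 0 ≤ t) (i j : Fin n) : 0 ≤ consensusFlow w t i j := by
  obtain ⟨d, hd⟩ := exists_shift_nonneg hw
  rw [consensusFlow_eq w t d]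
  exact mul_nonneg (Real.exp_pos _).le
    (exp_apply_nonneg (fun i j => mul_nonneg ht ((hw i j).trans (hd i j))) i j)

theorem consensusFlow_pos {w : Matrix (Fin n) (Fin n) ℝ} (hw : ∀ i j, 0 ≤ w i j) {t : ℝ}
    (ht : 0 < t) {r i : Fin n} (h : Relation.ReflTransGen (fun j i => 0 < w i j) r i) :
    0 < consensusFlow w t i r := by
  obtain ⟨d, hd⟩ := exists_shift_nonneg hw
  rw [consensusFlow_eq w t d]
  exact mul_pos (Real.exp_pos _)
    (exp_apply_pos (fun i j => mul_nonneg ht.le ((hw i j).trans (hd i j)))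
      (Relation.ReflTransGen.mono (fun a b hab => mul_pos ht (hab.trans_le (hd b a))) _ _ h))

/-- Block triangularity with respect to `U` survives products, hence holds for all terms of the
exponential series. -/
theorem consensusFlow_eq_zero {w : Matrix (Fin n) (Fin n) ℝ} {U : Set (Fin n)}
    (hU : ∀ i ∈ U, ∀ j ∉ U, w i j = 0) (t : ℝ) {i j : Fin n} (hi : i ∈ U) (hj : j ∉ U) :
    consensusFlow w t i j = 0 := by
  have hM : ∀ i ∈ U, ∀ j ∉ U, (t • negLaplacian w) i j = 0 := by
    intro i hi j hj
    have : i ≠ j := fun h => hj (h ▸ hi)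
    simp [negLaplacian, Matrix.diagonal_apply_ne _ this, hU i hi j hj]
  have hk : ∀ k : ℕ, ((t • negLaplacian w) ^ k) i j = 0 := by
    intro k
    induction k generalizing i with
    | zero => rw [pow_zero, Matrix.one_apply_ne]; exact fun h => hj (h ▸ hi)
    | succ k ih =>
      rw [pow_succ', Matrix.mul_apply]
      refine Finset.sum_eq_zero fun l _ => ?_
      by_cases hl : l ∈ U
      · rw [ih hl, mul_zero]
      · rw [hM i hi l hl, zero_mul]
  have h := hasSum_exp_apply (t • negLaplacian w) i j
  have h0 : (fun k : ℕ => ((k.factorial : ℝ)⁻¹ • (t • negLaplacian w) ^ k) i j) = fun _ => 0 := by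
    funext k
    rw [Matrix.smul_apply, hk, smul_zero]
  rw [h0] at h
  exact h.unique hasSum_zero

/-- The flow solves the consensus equation. -/
theorem hasDerivAt_sum_consensusFlow {V : Type*} [NormedAddCommGroup V] [NormedSpace ℝ V]
    (w : Matrix (Fin n) (Fin n) ℝ) (y : Fin n → V) (t : ℝ) (i : Fin n) :
    HasDerivAt (fun s => ∑ j, consensusFlow w s i j • y j)
      (-∑ j, w i j • (∑ k, consensusFlow w t i k • y k - ∑ k, consensusFlow w t j k • y k)) t := by
  have h := HasDerivAt.fun_sum (u := Finset.univ) fun j _ =>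
    (hasDerivAt_consensusFlow w t i j).smul_const (y j)
  convert h using 1
  rw [← sum_negLaplacian_smul w (fun i => ∑ k, consensusFlow w t i k • y k) i]
  simp only [Matrix.mul_apply, Finset.smul_sum, Finset.sum_smul, smul_smul]
  exact Finset.sum_comm

/-- Solutions of the consensus equation are given by the flow. -/
theorem eq_sum_consensusFlow {V : Type*} [NormedAddCommGroup V] [NormedSpace ℝ V]
    (w : Matrix (Fin n) (Fin n) ℝ) {y : Fin n → ℝ → V} {T : ℝ} (hT : 0 ≤ T)
    (hy : ∀ i, ∀ t ∈ Set.Icc 0 T,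
      HasDerivWithinAt (y i) (-∑ j, w i j • (y i t - y j t)) (Set.Ici 0) t) (i : Fin n) :
    y i T = ∑ j, consensusFlow w T i j • y j 0 := by
  -- Integrating factor: `exp(tL) y(t)` has derivative zero, because the flow commutes with its
  -- generator. The group law then inverts `exp(TL)`.
  have key : ∀ i, ∑ j, consensusFlow w (-T) i j • y j T = y i 0 := by
    intro i
    have hd : ∀ t ∈ Set.Icc 0 T,
        HasDerivWithinAt (fun t => ∑ j, consensusFlow w (-t) i j • y j t) 0 (Set.Ici 0) t := by
      intro t ht
      have h1 : ∀ j, HasDerivWithinAt (fun t => consensusFlow w (-t) i j)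
          (-(consensusFlow w (-t) * negLaplacian w) i j) (Set.Ici 0) t := fun j => by
        have h := (hasDerivAt_consensusFlow w (-t) i j).comp t (hasDerivAt_neg t)
        rw [commute_consensusFlow, mul_neg_one] at h
        exact h.hasDerivWithinAt
      have h2 : ∀ j, HasDerivWithinAt (y j) (∑ k, negLaplacian w j k • y k t) (Set.Ici 0) t :=
        fun j => (sum_negLaplacian_smul w (fun k => y k t) j).symm ▸ hy j t ht
      refine (HasDerivWithinAt.fun_sum (u := Finset.univ) fun j _ =>
        (h1 j).fun_smul (h2 j)).congr_deriv ?_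
      simp_rw [Finset.sum_add_distrib, neg_smul, Finset.sum_neg_distrib, Matrix.mul_apply,
        Finset.sum_smul, Finset.smul_sum, smul_smul]
      rw [Finset.sum_comm, add_neg_cancel]
    have := constant_of_has_deriv_right_zero
      (fun t ht => ((hd t ht).continuousWithinAt).mono Set.Icc_subset_Ici_self)
      (fun t ht => (hd t ⟨ht.1, ht.2.le⟩).mono (Set.Ici_subset_Ici.2 ht.1)) T ⟨hT, le_rfl⟩
    rw [this]
    simp [consensusFlow_zero, Matrix.one_apply, ite_smul]
  simp_rw [← key, Finset.smul_sum, smul_smul]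
  rw [Finset.sum_comm]
  simp only [← Finset.sum_smul, ← Matrix.mul_apply, ← consensusFlow_add, add_neg_cancel,
    consensusFlow_zero, Matrix.one_apply, ite_smul, one_smul, zero_smul, Finset.sum_ite_eq,
    Finset.mem_univ, if_true]

/-- The constant `1` solves the consensus equation, so the flow fixes it. -/
theorem sum_consensusFlow_eq_one (w : Matrix (Fin n) (Fin n) ℝ) {t : ℝ} (ht : 0 ≤ t) (i : Fin n) :
    ∑ j, consensusFlow w t i j = 1 := by
  have := eq_sum_consensusFlow w (y := fun _ _ => (1 : ℝ)) ht
    (fun i t _ => by simpa using hasDerivWithinAt_const t (Set.Ici 0) (1 : ℝ)) i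
  simpa using this.symm

/-- Each row of the flow is a vector of convex weights, and balls are convex. This is what keeps
rotation logarithms away from norm `π`. -/
theorem norm_sum_consensusFlow_le {V : Type*} [NormedAddCommGroup V] [NormedSpace ℝ V]
    {w : Matrix (Fin n) (Fin n) ℝ} (hw : ∀ i j, 0 ≤ w i j) {y : Fin n → V} {R : ℝ}
    (hy : ∀ i, ‖y i‖ ≤ R) {t : ℝ} (ht : 0 ≤ t) (i : Fin n) :
    ‖∑ j, consensusFlow w t i j • y j‖ ≤ R := by
  have : ∑ j, consensusFlow w t i j • y j ∈ Metric.closedBall (0 : V) R :=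
    (convex_closedBall (0 : V) R).sum_mem (fun j _ => consensusFlow_nonneg hw ht i j)
      (sum_consensusFlow_eq_one w ht i) (fun j _ => by simpa using hy j)
  simpa using this

end Flow

/-! ### Convergence of the semigroup by contraction -/

section Convergence

variable {n : ℕ}

theorem sum_mul_mem_Icc {p z : Fin n → ℝ} {lo hi : ℝ} (hp : ∀ j, 0 ≤ p j) (hp1 : ∑ j, p j = 1)
    (hz : ∀ j, z j ∈ Set.Icc lo hi) : ∑ j, p j * z j ∈ Set.Icc lo hi :=
  (convex_Icc lo hi).sum_mem (fun j _ => hp j) hp1 fun j _ => hz j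

/-- A probability vector with weight at least `δ` at `r` contracts intervals towards `z r`. -/
theorem sum_mul_mem_Icc_of_le {p z : Fin n → ℝ} {lo hi δ : ℝ} {r : Fin n} (hp : ∀ j, 0 ≤ p j)
    (hp1 : ∑ j, p j = 1) (hδ : δ ≤ p r) (hz : ∀ j, z j ∈ Set.Icc lo hi) :
    ∑ j, p j * z j ∈ Set.Icc (δ * z r + (1 - δ) * lo) (δ * z r + (1 - δ) * hi) := by
  have h1 := Finset.add_sum_erase Finset.univ (fun j => p j * z j) (Finset.mem_univ r)
  have h2 := Finset.add_sum_erase Finset.univ p (Finset.mem_univ r)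
  have h3 : ∑ j ∈ Finset.univ.erase r, p j * lo ≤ ∑ j ∈ Finset.univ.erase r, p j * z j :=
    Finset.sum_le_sum fun j _ => mul_le_mul_of_nonneg_left (hz j).1 (hp j)
  have h4 : ∑ j ∈ Finset.univ.erase r, p j * z j ≤ ∑ j ∈ Finset.univ.erase r, p j * hi :=
    Finset.sum_le_sum fun j _ => mul_le_mul_of_nonneg_left (hz j).2 (hp j)
  rw [← Finset.sum_mul] at h3 h4
  have h5 : ∑ j ∈ Finset.univ.erase r, p j = 1 - p r := by linarith
  rw [h5] at h3 h4
  rw [← h1]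
  constructor <;> nlinarith [(hz r).1, (hz r).2]

/-- If some vertex reaches all the others, the consensus semigroup converges to a matrix with equal
rows. -/
theorem exists_tendsto_consensusFlow {w : Matrix (Fin n) (Fin n) ℝ} (hw : ∀ i j, 0 ≤ w i j)
    {r : Fin n} (hr : ∀ i, Relation.ReflTransGen (fun j i => 0 < w i j) r i) (j : Fin n) :
    ∃ ν : ℝ, ∀ i, Tendsto (fun t => consensusFlow w t i j) atTop (𝓝 ν) := by
  -- The smallest entry of column `r` at time `1` is a positive weight that every row gives to `r`.
  obtain ⟨i₀, -, hi₀⟩ := Finset.exists_min_image Finset.univ (fun i => consensusFlow w 1 i r)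
    ⟨r, Finset.mem_univ r⟩
  set δ := consensusFlow w 1 i₀ r
  have hδ : 0 < δ := consensusFlow_pos hw one_pos (hr i₀)
  have hδ1 : δ ≤ 1 := (Finset.single_le_sum (f := fun j => consensusFlow w 1 i₀ j)
    (fun j _ => consensusFlow_nonneg hw zero_le_one i₀ j) (Finset.mem_univ r)).trans_eq
    (sum_consensusFlow_eq_one w zero_le_one i₀)
  have key : ∀ k : ℕ, ∃ lo hi : ℝ, hi - lo = (1 - δ) ^ k ∧
      ∀ t : ℝ, k ≤ t → ∀ i, consensusFlow w t i j ∈ Set.Icc lo hi := by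
    intro k
    induction k with
    | zero =>
      refine ⟨0, 1, by simp, fun t ht i => ?_⟩
      rw [Nat.cast_zero] at ht
      exact ⟨consensusFlow_nonneg hw ht i j, (Finset.single_le_sum
        (f := fun j => consensusFlow w t i j) (fun j _ => consensusFlow_nonneg hw ht i j)
        (Finset.mem_univ j)).trans_eq (sum_consensusFlow_eq_one w ht i)⟩
    | succ k ih =>
      obtain ⟨lo, hi, hlh, h⟩ := ih
      refine ⟨δ * consensusFlow w k r j + (1 - δ) * lo, δ * consensusFlow w k r j + (1 - δ) * hi,
        by rw [pow_succ, ← hlh]; ring, fun t ht i => ?_⟩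
      -- Starting from the values at time exactly `k`, one unit of time contracts the interval
      -- towards the value at `r`; the remaining time only averages inside the contracted interval.
      have e : t = (t - (k + 1)) + (1 + k) := by ring
      push_cast at ht
      rw [e, consensusFlow_add, Matrix.mul_apply]
      refine sum_mul_mem_Icc (consensusFlow_nonneg hw (by linarith) i)
        (sum_consensusFlow_eq_one w (by linarith) i) fun l => ?_
      rw [consensusFlow_add, Matrix.mul_apply]
      exact sum_mul_mem_Icc_of_le (consensusFlow_nonneg hw zero_le_one l)
        (sum_consensusFlow_eq_one w zero_le_one l) (hi₀ l (Finset.mem_univ l))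
        fun m => h k le_rfl m
  have hdist : ∀ ε > 0, ∃ T : ℝ, ∀ s ≥ T, ∀ t ≥ T, ∀ i l,
      dist (consensusFlow w s i j) (consensusFlow w t l j) < ε := by
    intro ε hε
    obtain ⟨k, hk⟩ := exists_pow_lt_of_lt_one hε (show 1 - δ < 1 by linarith)
    obtain ⟨lo, hi, hlh, h⟩ := key k
    refine ⟨k, fun s hs t ht i l => (Real.dist_le_of_mem_Icc (h s hs i) (h t ht l)).trans_lt ?_⟩
    rwa [hlh]
  have hc : CauchySeq fun t => consensusFlow w t r j := Metric.cauchySeq_iff.2 fun ε hε =>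
    (hdist ε hε).imp fun T hT s hs t ht => hT s hs t ht r r
  obtain ⟨ν, hν⟩ := cauchySeq_tendsto_of_complete hc
  refine ⟨ν, fun i => ?_⟩
  refine tendsto_of_tendsto_of_dist hν (Metric.tendsto_atTop.2 fun ε hε => ?_)
  obtain ⟨T, hT⟩ := hdist ε hε
  exact ⟨T, fun t ht => by
    rw [Real.dist_0_eq_abs, abs_of_nonneg dist_nonneg]; exact hT t ht t ht r i⟩

end Convergence

/-! ### Reachability and directed spanning trees -/

section Graph

/-- `v` is reached from `r` by a walk of length `k`. -/
def ReachIn {V : Type*} (G : Digraph V) (r : V) : ℕ → V → Prop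
  | 0, v => v = r
  | k + 1, v => ∃ u, ReachIn G r k u ∧ G.Adj u v

theorem exists_reachIn {V : Type*} {G : Digraph V} {r v : V}
    (h : Relation.ReflTransGen G.Adj r v) : ∃ k, ReachIn G r k v := by
  induction h with
  | refl => exact ⟨0, rfl⟩
  | tail _ hbc ih => exact ih.imp' Nat.succ fun k hk => ⟨_, hk, hbc⟩

/-- A directed spanning tree exists as soon as one vertex reaches all the others. -/
theorem hasDirectedSpanningTree_of_reach {V : Type*} {G : Digraph V} {r : V}
    (h : ∀ v, Relation.ReflTransGen G.Adj r v) : HasDirectedSpanningTree G := by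
  classical
  have hex : ∀ v, ∃ k, ReachIn G r k v := fun v => exists_reachIn (h v)
  -- Breadth-first distance from `r`. Keeping for each `v ≠ r` one incoming edge from a strictly
  -- closer vertex gives the tree.
  let d : V → ℕ := fun v => Nat.find (hex v)
  have hpar : ∀ v, v ≠ r → ∃ u, d u < d v ∧ G.Adj u v := by
    intro v hv
    have hd : ReachIn G r (d v) v := Nat.find_spec (hex v)
    rcases hk : d v with _ | k
    · rw [hk] at hd
      exact absurd hd hv
    · rw [hk] at hd
      obtain ⟨u, hu, huv⟩ := hd
      exact ⟨u, Nat.lt_succ_of_le (Nat.find_min' (hex u) hu), huv⟩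
  choose! par hlt hadj using hpar
  refine ⟨⟨fun u v => v ≠ r ∧ u = par v⟩, r, ?_, ?_, ?_, ?_⟩
  · rintro u v ⟨hv, rfl⟩
    exact hadj v hv
  · exact fun u hu => hu.1 rfl
  · exact fun v hv => ⟨par v, ⟨hv, rfl⟩, fun u hu => hu.2⟩
  · intro v
    induction hm : d v using Nat.strong_induction_on generalizing v with
    | _ m ih =>
      by_cases hv : v = r
      · exact hv ▸ Relation.ReflTransGen.refl
      · exact (ih (d (par v)) (hm ▸ hlt v hv) (par v) rfl).tail ⟨hv, rfl⟩

theorem HasDirectedSpanningTree.exists_reach {V : Type*} {G : Digraph V}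
    (h : HasDirectedSpanningTree G) : ∃ r, ∀ v, Relation.ReflTransGen G.Adj r v := by
  obtain ⟨T, r, hT, -, -, hr⟩ := h
  exact ⟨r, fun v => Relation.ReflTransGen.mono hT _ _ (hr v)⟩

/-- A finite digraph in which every two vertices have a common ancestor has a directed spanning
tree. -/
theorem hasDirectedSpanningTree_of_common_ancestor {V : Type*} [Finite V] [Nonempty V]
    {G : Digraph V} (h : ∀ u v, ∃ r, Relation.ReflTransGen G.Adj r u ∧
      Relation.ReflTransGen G.Adj r v) : HasDirectedSpanningTree G := by
  have := Fintype.ofFinite V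
  -- Common ancestors of pairs give common ancestors of finite sets: an ancestor shared by `a` and
  -- by an ancestor of all of `s` serves `insert a s`.
  have hs : ∀ s : Finset V, ∃ r, ∀ v ∈ s, Relation.ReflTransGen G.Adj r v := by
    classical
    intro s
    induction s using Finset.induction_on with
    | empty => exact ⟨Classical.arbitrary V, by simp⟩
    | insert a s _ ih =>
      obtain ⟨r, hr⟩ := ih
      obtain ⟨q, hqr, hqa⟩ := h r a
      refine ⟨q, fun v hv => ?_⟩
      rcases Finset.mem_insert.1 hv with rfl | hv
      · exact hqa
      · exact hqr.trans (hr v hv)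
  obtain ⟨r, hr⟩ := hs Finset.univ
  exact hasDirectedSpanningTree_of_reach fun v => hr v (Finset.mem_univ v)

end Graph

/-! ### The consensus flow of a weighted digraph -/

section WeightedDigraph

variable {n : ℕ} (G : WeightedDigraph n)

theorem WeightedDigraph.weight_nonneg (i j : Fin n) : 0 ≤ G.weight i j := by
  by_cases h : G.Adj j i
  · exact (G.weight_pos i j h).le
  · exact (G.weight_eq_zero i j h).ge

theorem WeightedDigraph.exists_tendsto_flow (hG : HasDirectedSpanningTree G.toDigraph) :
    ∃ ν : Fin n → ℝ, ∀ i j, Tendsto (fun t => consensusFlow G.weight t i j) atTop (𝓝 (ν j)) := by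
  obtain ⟨r, hr⟩ := hG.exists_reach
  choose ν hν using exists_tendsto_consensusFlow G.weight_nonneg
    fun i => Relation.ReflTransGen.mono (fun a b hab => G.weight_pos b a hab) _ _ (hr i)
  exact ⟨ν, fun i j => hν j i⟩

/-- Without a directed spanning tree, some initial values never reach consensus. -/
theorem WeightedDigraph.exists_constant_gap (hn : 0 < n)
    (hG : ¬ HasDirectedSpanningTree G.toDigraph) :
    ∃ (z : Fin n → ℝ) (i j : Fin n), ∀ t, 0 ≤ t → ∑ k, consensusFlow G.weight t i k * z k = 1 ∧
      ∑ k, consensusFlow G.weight t j k * z k = 0 := by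
  classical
  have : Nonempty (Fin n) := ⟨⟨0, hn⟩⟩
  have h := mt hasDirectedSpanningTree_of_common_ancestor hG
  push Not at h
  obtain ⟨i, j, hij⟩ := h
  -- The ancestors of `v` contain all their own parents, so row `v` of the flow is supported on
  -- them.
  have hU : ∀ v, ∀ a ∈ {a | Relation.ReflTransGen G.Adj a v},
      ∀ b ∉ {a | Relation.ReflTransGen G.Adj a v}, G.weight a b = 0 :=
    fun v a ha b hb => G.weight_eq_zero a b fun hab => hb (Relation.ReflTransGen.head hab ha)
  -- The indicator of the ancestors of `i` equals one on the support of row `i` and vanishes on that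
  -- of row `j`.
  refine ⟨fun k => if Relation.ReflTransGen G.Adj k i then 1 else 0, i, j, fun t ht => ⟨?_, ?_⟩⟩
  · refine (Finset.sum_congr rfl fun k _ => ?_).trans (sum_consensusFlow_eq_one G.weight ht i)
    dsimp only
    split_ifs with hk
    · rw [mul_one]
    · rw [consensusFlow_eq_zero (hU i) t Relation.ReflTransGen.refl hk, zero_mul]
  · refine Finset.sum_eq_zero fun k _ => ?_
    dsimp only
    split_ifs with hk
    · rw [consensusFlow_eq_zero (hU j) t Relation.ReflTransGen.refl (hij k hk), zero_mul]
    · rw [mul_zero]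

end WeightedDigraph

/-! ### Lifting differentiability through an immersion -/

section InverseFunction

/-- A curve whose image under a map with injective derivative is differentiable is itself
differentiable. -/
theorem hasDerivWithinAt_of_comp_injective {E F : Type*} [NormedAddCommGroup E] [NormedSpace ℝ E]
    [FiniteDimensional ℝ E] [NormedAddCommGroup F] [NormedSpace ℝ F] [FiniteDimensional ℝ F]
    {f : E → F} {A : E →L[ℝ] F}
    {g : ℝ → E} {t : ℝ} {s : Set ℝ} {u : E} (hf : HasStrictFDerivAt f A (g t))
    (hA : Function.Injective A) (hg : ContinuousWithinAt g s t)
    (hfg : HasDerivWithinAt (fun a => f (g a)) (A u) s t) (ht : t ∈ s) :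
    HasDerivWithinAt g u s t := by
  have : CompleteSpace E := FiniteDimensional.complete ℝ E
  -- Composing `f` with a linear left inverse of `A` gives derivative the identity, so the inverse
  -- function theorem applies; continuity of `g` keeps the curve where the local inverse recovers
  -- it.
  obtain ⟨B, hB⟩ := LinearMap.exists_leftInverse_of_injective (A : E →ₗ[ℝ] F)
    (LinearMap.ker_eq_bot.2 hA)
  have hBA : ∀ v, B (A v) = v := fun v => LinearMap.congr_fun hB v
  set B' : F →L[ℝ] E := LinearMap.toContinuousLinearMap B
  have h1 : HasStrictFDerivAt (fun v => B' (f v))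
      ((ContinuousLinearEquiv.refl ℝ E : E ≃L[ℝ] E) : E →L[ℝ] E) (g t) := by
    refine (B'.hasStrictFDerivAt.comp (g t) hf).congr_fderiv ?_
    ext v
    exact hBA v
  have h2 := h1.to_localInverse
  have h3 : HasDerivWithinAt (fun a => B' (f (g a))) u s t := by
    have := B'.hasFDerivAt.comp_hasDerivWithinAt t hfg
    rwa [show B' (A u) = u from hBA u] at this
  have h4 := h2.hasFDerivAt.comp_hasDerivWithinAt_of_eq t h3 rfl
  refine h4.congr_of_eventuallyEq_of_mem ?_ ht
  filter_upwards [hg.eventually h1.eventually_left_inverse] with a ha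
  exact ha.symm

end InverseFunction

/-! ### Exponential and logarithm of unit quaternions -/

section QuaternionLog

theorem hasStrictFDerivAt_exp (q : ℍ[ℝ]) :
    HasStrictFDerivAt (NormedSpace.exp : ℍ[ℝ] → ℍ[ℝ])
      (fderiv ℝ (NormedSpace.exp : ℍ[ℝ] → ℍ[ℝ]) q) q :=
  (NormedSpace.exp_analytic (𝕂 := ℝ) q).hasStrictFDerivAt

theorem hasDerivAt_exp_line (y u : ℍ[ℝ]) :
    HasDerivAt (fun t : ℝ => (NormedSpace.exp (y + t • u) : ℍ[ℝ]))
      (fderiv ℝ (NormedSpace.exp : ℍ[ℝ] → ℍ[ℝ]) y u) 0 := by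
  have h : HasDerivAt (fun t : ℝ => y + t • u) u 0 := by
    simpa using ((hasDerivAt_id (0 : ℝ)).smul_const u).const_add y
  exact (hasStrictFDerivAt_exp y).hasFDerivAt.comp_hasDerivAt_of_eq 0 h (by simp)

theorem norm_exp_of_re_eq_zero {y : ℍ[ℝ]} (hy : y.re = 0) :
    ‖(NormedSpace.exp y : ℍ[ℝ])‖ = 1 := by
  rw [Quaternion.norm_exp, hy]; simp

theorem mul_star_of_norm_eq_one {r : ℍ[ℝ]} (hr : ‖r‖ = 1) : r * star r = 1 := by
  rw [Quaternion.self_mul_star, Quaternion.normSq_eq_norm_mul_self, hr]; simp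

theorem star_mul_of_norm_eq_one {r : ℍ[ℝ]} (hr : ‖r‖ = 1) : star r * r = 1 := by
  rw [Quaternion.star_mul_self, Quaternion.normSq_eq_norm_mul_self, hr]; simp

/-- The derivative of the exponential on pure quaternions is tangent to the unit sphere. -/
theorem fderiv_exp_mul_star_re {y u : ℍ[ℝ]} (hy : y.re = 0) (hu : u.re = 0) :
    (fderiv ℝ (NormedSpace.exp : ℍ[ℝ] → ℍ[ℝ]) y u * star (NormedSpace.exp y : ℍ[ℝ])).re = 0 := by
  have h := (hasDerivAt_exp_line y u).norm_sq
  have h1 : (fun t : ℝ => ‖(NormedSpace.exp (y + t • u) : ℍ[ℝ])‖ ^ 2) = fun _ => 1 := by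
    funext t
    rw [norm_exp_of_re_eq_zero (by simp [hy, hu]), one_pow]
  rw [h1] at h
  have h2 := h.unique (hasDerivAt_const 0 (1 : ℝ))
  rw [zero_smul, add_zero, real_inner_comm, Quaternion.inner_def] at h2
  linarith

/-- The exponential is an immersion of the open ball of radius `π` of pure quaternions. -/
theorem eq_zero_of_fderiv_exp_eq_zero {y u : ℍ[ℝ]} (hy : y.re = 0) (hu : u.re = 0)
    (hπ : ‖y‖ < Real.pi) (h : fderiv ℝ (NormedSpace.exp : ℍ[ℝ] → ℍ[ℝ]) y u = 0) : u = 0 := by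
  by_cases h0 : y = 0
  · subst h0
    rw [(hasFDerivAt_exp_zero (𝕂 := ℝ) (𝔸 := ℍ[ℝ])).fderiv] at h
    exact h
  have hpos : 0 < ‖y‖ := norm_pos_iff.2 h0
  have hsin : 0 < Real.sin ‖y‖ := Real.sin_pos_of_pos_of_lt_pi hpos hπ
  have hline : HasDerivAt (fun t : ℝ => y + t • u) u 0 := by
    simpa using ((hasDerivAt_id (0 : ℝ)).smul_const u).const_add y
  obtain ⟨d, hd⟩ : ∃ d, HasDerivAt (fun t : ℝ => ‖y + t • u‖) d 0 := by
    have h1 : DifferentiableAt ℝ (fun t : ℝ => ‖y + t • u‖) 0 :=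
      DifferentiableAt.norm ℝ hline.differentiableAt (by simpa using h0)
    exact ⟨_, h1.hasDerivAt⟩
  have hexp := hasDerivAt_exp_line y u
  rw [h] at hexp
  have hform : (fun t : ℝ => (NormedSpace.exp (y + t • u) : ℍ[ℝ])) = fun t : ℝ =>
      Real.cos ‖y + t • u‖ • (1 : ℍ[ℝ]) + (Real.sin ‖y + t • u‖ / ‖y + t • u‖) • (y + t • u) := by
    funext t
    rw [Quaternion.exp_of_re_eq_zero _ (by simp [hy, hu]), ← Quaternion.coe_mul_eq_smul _ 1,
      mul_one]
  have hder := ((hd.cos.smul_const (1 : ℍ[ℝ])).add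
    ((hd.sin.div hd (by simpa using hpos.ne')).smul hline))
  have heq := hder.unique (hform ▸ hexp)
  simp only [zero_smul, add_zero] at heq
  -- The real part reads `-sin ‖y‖ * d = 0`, so the norm has derivative `d = 0`, and what remains is
  -- `(sin ‖y‖ / ‖y‖) • u = 0`.
  have hre := congrArg (fun q : ℍ[ℝ] => q.re) heq
  simp [hy, hu, hsin.ne'] at hre
  subst hre
  simpa [hsin.ne', hpos.ne'] using heq

theorem norm_im_eq_sin {y : ℍ[ℝ]} (hy : y.re = 0) (hπ : ‖y‖ ≤ Real.pi) :
    ‖(NormedSpace.exp y : ℍ[ℝ]).im‖ = Real.sin ‖y‖ := by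
  by_cases h0 : y = 0
  · simp [h0]
  have him : y.im = y := by ext <;> simp [hy]
  rw [Quaternion.im_exp, hy, him, NormedSpace.exp_zero, one_mul, norm_smul, Real.norm_eq_abs,
    abs_div, abs_norm, div_mul_cancel₀ _ (norm_ne_zero_iff.2 h0),
    abs_of_nonneg (Real.sin_nonneg_of_nonneg_of_le_pi (norm_nonneg _) hπ)]

theorem re_exp_of_re_eq_zero {y : ℍ[ℝ]} (hy : y.re = 0) :
    (NormedSpace.exp y : ℍ[ℝ]).re = Real.cos ‖y‖ := by
  rw [Quaternion.re_exp, hy]; simp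

theorem logQ_exp {y : ℍ[ℝ]} (hy : y.re = 0) (hπ : ‖y‖ < Real.pi) :
    logQ (NormedSpace.exp y) = y := by
  by_cases h0 : y = 0
  · simp [h0, logQ, rotAxis]
  have him : y.im = y := by ext <;> simp [hy]
  have hsin : 0 < Real.sin ‖y‖ := Real.sin_pos_of_pos_of_lt_pi (norm_pos_iff.2 h0) hπ
  rw [logQ, rotAngle, rotAxis, norm_im_eq_sin hy hπ.le, re_exp_of_re_eq_zero hy,
    Real.arccos_cos (norm_nonneg _) hπ.le, Quaternion.im_exp, him, hy, NormedSpace.exp_zero,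
    smul_smul, smul_smul]
  convert one_smul ℝ y
  field_simp

theorem logQ_re (r : ℍ[ℝ]) : (logQ r).re = 0 := by simp [logQ, rotAxis]

/-- The axis always has norm at most one, being `0` when the imaginary part vanishes. The bound
gives continuity of `logQ` at `1`, where the axis is discontinuous. -/
theorem norm_logQ_le (r : ℍ[ℝ]) : ‖logQ r‖ ≤ Real.arccos r.re := by
  have h1 : ‖rotAxis r‖ ≤ 1 := by
    rw [rotAxis, norm_smul, norm_inv, norm_norm]
    exact inv_mul_le_one
  have h2 : rotAngle r / 2 = Real.arccos r.re := by rw [rotAngle]; ring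
  rw [logQ, h2, norm_smul, Real.norm_eq_abs, abs_of_nonneg (Real.arccos_nonneg _)]
  exact mul_le_of_le_one_right (Real.arccos_nonneg _) h1

theorem logQ_one : logQ 1 = 0 := by simp [logQ, rotAxis]

theorem norm_logQ_lt_pi {r : ℍ[ℝ]} (hr : ‖r‖ = 1) (h1 : r ≠ -1) : ‖logQ r‖ < Real.pi := by
  have h := (polar_form r hr h1).2.1.2
  have h2 : rotAngle r = 2 * Real.arccos r.re := rfl
  linarith [norm_logQ_le r]

theorem exp_logQ {r : ℍ[ℝ]} (hr : ‖r‖ = 1) (h1 : r ≠ -1) : NormedSpace.exp (logQ r) = r := by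
  by_cases h : r = 1
  · rw [h, logQ_one, NormedSpace.exp_zero]
  obtain ⟨hp, ⟨h0, -⟩, -, hn⟩ := polar_form r hr h1
  have hnorm : ‖logQ r‖ = rotAngle r / 2 := by
    rw [logQ, norm_smul, hn h, mul_one, Real.norm_eq_abs, abs_of_nonneg (by linarith)]
  rw [Quaternion.exp_of_re_eq_zero _ (logQ_re r), hnorm]
  conv_rhs => rw [hp]
  rw [logQ, smul_smul]
  by_cases h2 : rotAngle r / 2 = 0
  · simp [h2]
  · rw [div_mul_cancel₀ _ h2]

theorem continuousAt_logQ {r : ℍ[ℝ]} (hr : ‖r‖ = 1) (h1 : r ≠ -1) : ContinuousAt logQ r := by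
  by_cases h : r = 1
  · subst h
    rw [ContinuousAt, logQ_one]
    refine squeeze_zero_norm norm_logQ_le ?_
    have : Tendsto (fun q : ℍ[ℝ] => Real.arccos q.re) (𝓝 1) (𝓝 (Real.arccos (1 : ℍ[ℝ]).re)) :=
      (Real.continuous_arccos.comp Quaternion.continuous_re).continuousAt
    simpa using this
  · have him : ‖r.im‖ ≠ 0 := by
      intro h2
      have h3 := (polar_form r hr h1).2.2.2 h
      rw [rotAxis, h2] at h3
      simp at h3
    have c1 : ContinuousAt (fun q : ℍ[ℝ] => q.im) r := Quaternion.continuous_im.continuousAt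
    have c2 : ContinuousAt (fun q : ℍ[ℝ] => Real.arccos q.re) r :=
      (Real.continuous_arccos.comp Quaternion.continuous_re).continuousAt
    exact (((c2.const_mul 2).div_const 2)).smul ((c1.norm.inv₀ him).smul c1)

theorem pureQ_add (a b : Fin 3 → ℝ) : pureQ (a + b) = pureQ a + pureQ b :=
  Quaternion.ext _ _ (add_zero 0).symm rfl rfl rfl

theorem pureQ_smul (c : ℝ) (a : Fin 3 → ℝ) : pureQ (c • a) = c • pureQ a :=
  Quaternion.ext _ _ (mul_zero c).symm rfl rfl rfl

/-- The Euclidean coordinates of pure quaternions, as a continuous linear map. -/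
def pureL : (Fin 3 → ℝ) →L[ℝ] ℍ[ℝ] := LinearMap.toContinuousLinearMap
  { toFun := pureQ
    map_add' := pureQ_add
    map_smul' := pureQ_smul }

theorem pureL_apply (v : Fin 3 → ℝ) : pureL v = pureQ v := rfl

/-- The imaginary coordinates, as a continuous linear map. -/
def vec3L : ℍ[ℝ] →L[ℝ] (Fin 3 → ℝ) := LinearMap.toContinuousLinearMap
  { toFun := vec3
    map_add' := fun a b => by ext i; fin_cases i <;> simp [vec3]
    map_smul' := fun c a => by ext i; fin_cases i <;> simp [vec3] }

theorem vec3L_apply (q : ℍ[ℝ]) : vec3L q = vec3 q := rfl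

/-- The coordinates, as a continuous linear map. -/
def vec4L : ℍ[ℝ] →L[ℝ] (Fin 4 → ℝ) := LinearMap.toContinuousLinearMap
  { toFun := vec4
    map_add' := fun a b => by ext i; fin_cases i <;> simp [vec4]
    map_smul' := fun c a => by ext i; fin_cases i <;> simp [vec4] }

theorem vec4L_apply (q : ℍ[ℝ]) : vec4L q = vec4 q := rfl

theorem pureQ_vec3 {q : ℍ[ℝ]} (hq : q.re = 0) : pureQ (vec3 q) = q := by
  ext <;> simp [pureQ, vec3, hq]

theorem vec3_pureQ (v : Fin 3 → ℝ) : vec3 (pureQ v) = v := by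
  ext i; fin_cases i <;> simp [pureQ, vec3]

theorem vec4_injective : Function.Injective vec4 := by
  intro a b h
  have h0 := congrFun h 0
  have h1 := congrFun h 1
  have h2 := congrFun h 2
  have h3 := congrFun h 3
  simp [vec4] at h0 h1 h2 h3
  ext <;> assumption

/-- Logarithmic coordinates along a curve of rotations solve the lifted equation. -/
theorem hasDerivWithinAt_logQ {r : ℝ → ℍ[ℝ]} {s : Set ℝ} {t : ℝ} {u : ℍ[ℝ]} (ht : t ∈ s)
    (hr : ∀ a ∈ s, ‖r a‖ = 1) (h1 : r t ≠ -1) (hu : u.re = 0)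
    (hd : HasDerivWithinAt r
      (fderiv ℝ (NormedSpace.exp : ℍ[ℝ] → ℍ[ℝ]) (logQ (r t)) u) s t) :
    HasDerivWithinAt (fun a => logQ (r a)) u s t := by
  have hpure : ∀ q, pureL (vec3L (logQ q)) = logQ q := fun q => pureQ_vec3 (logQ_re q)
  have hc : ContinuousWithinAt (fun a => logQ (r a)) s t :=
    (continuousAt_logQ (hr t ht) h1).comp_continuousWithinAt hd.continuousWithinAt
  have hev : ∀ᶠ a in 𝓝[s] t, r a ≠ -1 := hd.continuousWithinAt.eventually_ne h1
  have key : HasDerivWithinAt (fun a => vec3L (logQ (r a))) (vec3L u) s t := by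
    -- Near `t` the exponential of `log r` is `r` itself. The coordinates in `ℝ³` matter, since the
    -- injectivity of the differential is established for pure directions only.
    refine hasDerivWithinAt_of_comp_injective
      (f := fun v => (NormedSpace.exp (pureL v) : ℍ[ℝ]))
      (A := (fderiv ℝ (NormedSpace.exp : ℍ[ℝ] → ℍ[ℝ]) (logQ (r t))).comp pureL) ?_ ?_ ?_ ?_ ht
    · refine HasStrictFDerivAt.comp _ ?_ pureL.hasStrictFDerivAt
      rw [hpure]
      exact hasStrictFDerivAt_exp _
    · rw [injective_iff_map_eq_zero]
      intro v hv
      have h := eq_zero_of_fderiv_exp_eq_zero (logQ_re _) (by simp [pureL_apply, pureQ])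
        (norm_logQ_lt_pi (hr t ht) h1) hv
      exact (vec3_pureQ v).symm.trans ((congrArg vec3L h).trans (map_zero vec3L))
    · exact vec3L.continuous.continuousAt.comp_continuousWithinAt hc
    · have : (fderiv ℝ (NormedSpace.exp : ℍ[ℝ] → ℍ[ℝ]) (logQ (r t))).comp pureL (vec3L u) =
          fderiv ℝ (NormedSpace.exp : ℍ[ℝ] → ℍ[ℝ]) (logQ (r t)) u :=
        congrArg _ (pureQ_vec3 hu)
      rw [this]
      refine hd.congr_of_eventuallyEq_of_mem ?_ ht
      filter_upwards [hev, self_mem_nhdsWithin] with a ha has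
      rw [hpure, exp_logQ (hr a has) ha]
  have h2 := pureL.hasFDerivAt.comp_hasDerivWithinAt t key
  have h3 : pureL (vec3L u) = u := pureQ_vec3 hu
  rw [h3] at h2
  exact h2.congr (fun a _ => (hpure (r a)).symm) (hpure (r t)).symm

/-- `Q r` represents the differential of the exponential at `log r`. -/
theorem Q_mulVec_vec3 (r : ℍ[ℝ]) {u : ℍ[ℝ]} (hu : u.re = 0) :
    Q r *ᵥ vec3 u = vec4 (fderiv ℝ (NormedSpace.exp : ℍ[ℝ] → ℍ[ℝ]) (logQ r) u) := by
  have hd : HasFDerivAt (fun v : Fin 3 → ℝ => vec4 (NormedSpace.exp (pureQ v)))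
      (vec4L.comp ((fderiv ℝ (NormedSpace.exp : ℍ[ℝ] → ℍ[ℝ]) (logQ r)).comp pureL))
      (vec3 (logQ r)) := by
    refine vec4L.hasFDerivAt.comp _ (HasFDerivAt.comp _ ?_ pureL.hasFDerivAt)
    rw [pureQ_vec3 (logQ_re r)]
    exact (hasStrictFDerivAt_exp _).hasFDerivAt
  have hQ : Q r = LinearMap.toMatrix' (vec4L.comp
      ((fderiv ℝ (NormedSpace.exp : ℍ[ℝ] → ℍ[ℝ]) (logQ r)).comp pureL) :
        (Fin 3 → ℝ) →ₗ[ℝ] Fin 4 → ℝ) := by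
    ext i j
    rw [Q, hd.fderiv, Matrix.of_apply, LinearMap.toMatrix'_apply]
    rfl
  rw [hQ, LinearMap.toMatrix'_mulVec]
  have h : pureL (vec3 u) = u := pureQ_vec3 hu
  simp [h, vec4L_apply]

end QuaternionLog

/-! ### Unit dual quaternions and exponential coordinates of poses -/

section DualQuaternion

theorem fst_mkDQ (a b : ℍ[ℝ]) : (mkDQ a b).fst = a := by simp [mkDQ]

theorem snd_mkDQ (a b : ℍ[ℝ]) : (mkDQ a b).snd = b := by simp [mkDQ]

theorem DQ.ext {x y : DQ} (h1 : x.fst = y.fst) (h2 : x.snd = y.snd) : x = y :=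
  TrivSqZeroExt.ext h1 h2

theorem fst_mul (x y : DQ) : (x * y).fst = x.fst * y.fst := rfl

theorem snd_mul (x y : DQ) : (x * y).snd = x.fst * y.snd + x.snd * y.fst := by
  simp [TrivSqZeroExt.snd_mul]

theorem fst_conj (x : DQ) : (conj x).fst = star x.fst := fst_mkDQ _ _

theorem snd_conj (x : DQ) : (conj x).snd = star x.snd := snd_mkDQ _ _

/-- The two terms in the dual part of `x x*` are conjugate to each other, so they add up to a real
number, the real part of the translation. -/
theorem isUnitDQ_iff (x : DQ) : IsUnitDQ x ↔ ‖x.fst‖ = 1 ∧ (translation x).re = 0 := by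
  have e1 : (x * conj x).fst = ((‖x.fst‖ * ‖x.fst‖ : ℝ) : ℍ[ℝ]) := by
    rw [fst_mul, fst_conj, Quaternion.self_mul_star, Quaternion.normSq_eq_norm_mul_self]
  have e2 : (x * conj x).snd = (((translation x).re : ℝ) : ℍ[ℝ]) := by
    have h : x.fst * star x.snd = star (x.snd * star x.fst) := by simp
    rw [snd_mul, snd_conj, fst_conj, h, add_comm, Quaternion.self_add_star', translation]
    simp
  constructor
  · intro h
    rw [IsUnitDQ] at h
    rw [h] at e1 e2
    have e3 : ((1 : ℝ) : ℍ[ℝ]) = _ := e1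
    have e4 : ((0 : ℝ) : ℍ[ℝ]) = _ := e2
    rw [Quaternion.coe_inj] at e3 e4
    refine ⟨?_, e4.symm⟩
    nlinarith [norm_nonneg x.fst]
  · rintro ⟨h1, h2⟩
    rw [h1] at e1
    rw [h2] at e2
    exact DQ.ext (by rw [e1]; simp) (by rw [e2]; simp)

theorem IsUnitDQ.norm_fst {x : DQ} (h : IsUnitDQ x) : ‖x.fst‖ = 1 := ((isUnitDQ_iff x).1 h).1

theorem IsUnitDQ.translation_re {x : DQ} (h : IsUnitDQ x) : (translation x).re = 0 :=
  ((isUnitDQ_iff x).1 h).2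

theorem IsUnitDQ.snd_eq {x : DQ} (h : IsUnitDQ x) :
    x.snd = (1 / 2 : ℝ) • (translation x * x.fst) := by
  rw [translation, smul_mul_assoc, smul_smul, mul_assoc, star_mul_of_norm_eq_one h.norm_fst]
  norm_num

theorem IsUnitDQ.conj_mul {x : DQ} (h : IsUnitDQ x) : conj x * x = 1 := by
  have hx := h.norm_fst
  refine DQ.ext ?_ ?_
  · rw [fst_mul, fst_conj, star_mul_of_norm_eq_one hx]; rfl
  · have hp : star (translation x) = -translation x := by
      rw [Quaternion.star_eq_neg]; exact h.translation_re
    rw [snd_mul, fst_conj, snd_conj, h.snd_eq]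
    simp [hp, mul_assoc]

/-- Poses in exponential coordinates. -/
def poseExp (a b : ℍ[ℝ]) : DQ := mkDQ (NormedSpace.exp a) (b * NormedSpace.exp a)

theorem fst_poseExp (a b : ℍ[ℝ]) : (poseExp a b).fst = NormedSpace.exp a := fst_mkDQ _ _

theorem snd_poseExp (a b : ℍ[ℝ]) : (poseExp a b).snd = b * NormedSpace.exp a := snd_mkDQ _ _

theorem translation_poseExp {a : ℍ[ℝ]} (ha : a.re = 0) (b : ℍ[ℝ]) :
    translation (poseExp a b) = (2 : ℝ) • b := by
  rw [translation, fst_poseExp, snd_poseExp, mul_assoc,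
    mul_star_of_norm_eq_one (norm_exp_of_re_eq_zero ha), mul_one]

theorem isUnitDQ_poseExp {a b : ℍ[ℝ]} (ha : a.re = 0) (hb : b.re = 0) :
    IsUnitDQ (poseExp a b) := by
  rw [isUnitDQ_iff, fst_poseExp, translation_poseExp ha]
  exact ⟨norm_exp_of_re_eq_zero ha, by simp [hb]⟩

theorem poseExp_log {x : DQ} (h : IsUnitDQ x) (h1 : x.fst ≠ -1) :
    poseExp (logQ x.fst) ((1 / 2 : ℝ) • translation x) = x := by
  refine DQ.ext ?_ ?_
  · rw [fst_poseExp, exp_logQ h.norm_fst h1]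
  · rw [snd_poseExp, exp_logQ h.norm_fst h1, smul_mul_assoc, ← h.snd_eq]

theorem logDQ_eq (x : DQ) : logDQ x = mkDQ (logQ x.fst) ((1 / 2 : ℝ) • translation x) := by
  refine DQ.ext ?_ ?_
  · rw [logDQ, TrivSqZeroExt.fst_smul, fst_mkDQ, fst_mkDQ, logQ, smul_smul, one_div_mul_eq_div]
  · rw [logDQ, TrivSqZeroExt.snd_smul, snd_mkDQ, snd_mkDQ]

theorem logDQ_poseExp {a b : ℍ[ℝ]} (ha : a.re = 0) (hπ : ‖a‖ < Real.pi) :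
    logDQ (poseExp a b) = mkDQ a b := by
  rw [logDQ_eq, translation_poseExp ha, fst_poseExp, logQ_exp ha hπ, smul_smul]
  norm_num

theorem fst_poseExp_ne {a b : ℍ[ℝ]} (ha : a.re = 0) (hπ : ‖a‖ < Real.pi) :
    (poseExp a b).fst ≠ -1 := by
  intro h
  have h1 := congrArg (fun q : ℍ[ℝ] => q.re) h
  simp only [fst_poseExp, re_exp_of_re_eq_zero ha, Quaternion.re_neg, Quaternion.re_one] at h1
  have h2 := Real.cos_lt_cos_of_nonneg_of_le_pi (norm_nonneg a) le_rfl hπ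
  rw [Real.cos_pi] at h2
  linarith

theorem continuous_mkDQ : Continuous fun p : ℍ[ℝ] × ℍ[ℝ] => mkDQ p.1 p.2 :=
  (TrivSqZeroExt.continuous_inl.comp continuous_fst).add
    (TrivSqZeroExt.continuous_inr.comp continuous_snd)

theorem continuous_poseExp : Continuous fun p : ℍ[ℝ] × ℍ[ℝ] => poseExp p.1 p.2 := by
  have he : Continuous (NormedSpace.exp : ℍ[ℝ] → ℍ[ℝ]) :=
    continuous_iff_continuousAt.2 fun q => (hasStrictFDerivAt_exp q).continuousAt
  exact continuous_mkDQ.comp ((he.comp continuous_fst).prodMk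
    (continuous_snd.mul (he.comp continuous_fst)))

theorem hasDerivWithinAt_DQ_iff {x : ℝ → DQ} {x' : DQ} {s : Set ℝ} {t : ℝ} :
    HasDerivWithinAt x x' s t ↔ HasDerivWithinAt (fun a => (x a).fst) x'.fst s t ∧
      HasDerivWithinAt (fun a => (x a).snd) x'.snd s t := by
  -- Dual quaternions are, by definition, pairs with the product topology and vector space
  -- structure.
  have h : HasDerivWithinAt x x' s t ↔
      HasDerivWithinAt (F := ℍ[ℝ] × ℍ[ℝ]) (fun a => ((x a).fst, (x a).snd)) (x'.fst, x'.snd) s t :=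
    Iff.rfl
  rw [h]
  constructor
  · intro h
    exact ⟨h.fst, h.snd⟩
  · rintro ⟨h1, h2⟩
    exact h1.prodMk h2

end DualQuaternion

/-! ### The protocol in the algebra of dual quaternions -/

section Hamilton

theorem hamiPlus4_mulVec (h q : ℍ[ℝ]) : hamiPlus4 h *ᵥ vec4 q = vec4 (h * q) := by
  ext i
  fin_cases i <;>
    simp [hamiPlus4, vec4, Matrix.mulVec, dotProduct, Fin.sum_univ_four] <;> ring

theorem hamiMinus4_mulVec (h q : ℍ[ℝ]) : hamiMinus4 h *ᵥ vec4 q = vec4 (q * h) := by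
  ext i
  fin_cases i <;>
    simp [hamiMinus4, vec4, Matrix.mulVec, dotProduct, Fin.sum_univ_four] <;> ring

theorem Qp_mulVec {q : ℍ[ℝ]} (hq : q.re = 0) : Qp *ᵥ vec3 q = vec4 q := by
  ext i
  fin_cases i <;> simp [Qp, vec3, vec4, Matrix.mulVec, dotProduct, Fin.sum_univ_three, hq]

theorem vec4_add (a b : ℍ[ℝ]) : vec4 (a + b) = vec4 a + vec4 b := map_add vec4L a b

theorem vec4_smul (c : ℝ) (a : ℍ[ℝ]) : vec4 (c • a) = c • vec4 a := map_smul vec4L c a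

theorem hamiMinus8_mulVec (x q : DQ) : hamiMinus8 x *ᵥ vec8 q = vec8 (q * x) := by
  rw [hamiMinus8, vec8, Matrix.fromBlocks_mulVec, vec8, fst_mul, snd_mul, vec4_add]
  simp [hamiMinus4_mulVec]

theorem vec8_injective : Function.Injective vec8 := by
  intro a b h
  refine DQ.ext (vec4_injective (funext fun i => ?_)) (vec4_injective (funext fun i => ?_))
  · exact congrFun h (Sum.inl i)
  · exact congrFun h (Sum.inr i)

theorem vec8_smul (c : ℝ) (x : DQ) : vec8 (c • x) = c • vec8 x := by
  ext i
  rcases i with i | i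
  · exact congrFun (vec4_smul c x.fst) i
  · exact congrFun (vec4_smul c x.snd) i

/-- The velocity of a pose whose logarithm has velocity `a + ε b`. -/
def poseVelocity (x : DQ) (a b : ℍ[ℝ]) : DQ :=
  mkDQ (fderiv ℝ (NormedSpace.exp : ℍ[ℝ] → ℍ[ℝ]) (logQ x.fst) a)
    ((1 / 2 : ℝ) • (translation x * fderiv ℝ (NormedSpace.exp : ℍ[ℝ] → ℍ[ℝ]) (logQ x.fst) a) +
      b * x.fst)

theorem Q8_mulVec (x : DQ) {a b : ℍ[ℝ]} (ha : a.re = 0) (hb : b.re = 0) :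
    Q8 x *ᵥ vec6 (mkDQ a b) = vec8 (poseVelocity x a b) := by
  rw [Q8, vec6, Matrix.fromBlocks_mulVec, vec8, poseVelocity]
  simp only [fst_mkDQ, snd_mkDQ, Sum.elim_comp_inl, Sum.elim_comp_inr, Matrix.zero_mulVec, add_zero,
    Matrix.smul_mulVec, ← Matrix.mulVec_mulVec, Q_mulVec_vec3 _ ha, hamiPlus4_mulVec,
    Qp_mulVec hb, hamiMinus4_mulVec, vec4_add, vec4_smul]

variable {n : ℕ} (G : WeightedDigraph n) (x : Fin n → DQ) (i : Fin n)

/-- The rotational part of the disagreement of agent `i`. -/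
def rotDisagreement : ℍ[ℝ] := ∑ j, G.weight i j • (logQ (x i).fst - logQ (x j).fst)

/-- The translational part of the disagreement of agent `i`. -/
def transDisagreement : ℍ[ℝ] :=
  ∑ j, G.weight i j • ((1 / 2 : ℝ) • translation (x i) - (1 / 2 : ℝ) • translation (x j))

theorem re_sum_smul {c : Fin n → ℝ} {y : Fin n → ℍ[ℝ]} (hy : ∀ j, (y j).re = 0) :
    (∑ j, c j • y j).re = 0 := by
  have h : (∑ j, c j • y j).re = ∑ j, (c j • y j).re :=
    map_sum (QuaternionAlgebra.reₗ (-1 : ℝ) 0 (-1)) _ _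
  rw [h]
  exact Finset.sum_eq_zero fun j _ => by simp [hy]

theorem rotDisagreement_re : (rotDisagreement G x i).re = 0 :=
  re_sum_smul fun j => by simp [logQ_re]

variable {x} in
theorem transDisagreement_re (hx : ∀ i, IsUnitDQ (x i)) : (transDisagreement G x i).re = 0 :=
  re_sum_smul fun j => by simp [(hx _).translation_re]

theorem sum_vec6 : ∑ j, G.weight i j • vec6 (logDQ (x i) - logDQ (x j)) =
    vec6 (mkDQ (rotDisagreement G x i) (transDisagreement G x i)) := by
  have e1 : vec3 (rotDisagreement G x i) =
      ∑ j, G.weight i j • vec3 (logQ (x i).fst - logQ (x j).fst) := by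
    rw [← vec3L_apply, rotDisagreement, map_sum]
    simp only [map_smul, vec3L_apply]
  have e2 : vec3 (transDisagreement G x i) = ∑ j, G.weight i j •
      vec3 ((1 / 2 : ℝ) • translation (x i) - (1 / 2 : ℝ) • translation (x j)) := by
    rw [← vec3L_apply, transDisagreement, map_sum]
    simp only [map_smul, vec3L_apply]
  ext k
  rw [Finset.sum_apply, vec6, fst_mkDQ, snd_mkDQ, e1, e2]
  simp only [logDQ_eq]
  rcases k with k | k
  · simp [vec6, fst_mkDQ]
  · simp [vec6, snd_mkDQ]

variable {x} in
/-- The protocol in the algebra of dual quaternions. -/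
theorem twistProtocol_eq (hx : ∀ i, IsUnitDQ (x i)) :
    twistProtocol G x i = vec8 ((-2 : ℝ) • (poseVelocity (x i) (rotDisagreement G x i)
      (transDisagreement G x i) * conj (x i))) := by
  rw [twistProtocol, sum_vec6, ← Matrix.mulVec_mulVec,
    Q8_mulVec _ (rotDisagreement_re G x i) (transDisagreement_re G i hx), hamiMinus8_mulVec,
    vec8_smul]

end Hamilton

/-! ### Kinematics and twists -/

section Kinematics

/-- Since `conj x` inverts `x`, the input `-2 v x*` produces the pose velocity `-v`. -/
theorem kinematics_of_unit {x : DQ} (hx : IsUnitDQ x) (v : DQ) :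
    (1 / 2 : ℝ) • (((-2 : ℝ) • (v * conj x)) * x) = -v := by
  have h : ((-2 : ℝ) • (v * conj x)) * x = (-2 : ℝ) • (v * conj x * x) :=
    DQ.ext (by simp) (by simp)
  rw [h, mul_assoc, hx.conj_mul, mul_one, smul_smul]
  norm_num

theorem poseVelocity_neg (x : DQ) (a b : ℍ[ℝ]) :
    poseVelocity x (-a) (-b) = -poseVelocity x a b := by
  refine DQ.ext ?_ ?_
  · simp [poseVelocity, fst_mkDQ]
  · rw [TrivSqZeroExt.snd_neg, poseVelocity, poseVelocity, snd_mkDQ, snd_mkDQ, map_neg, mul_neg,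
      smul_neg, neg_mul, neg_add]

/-- The protocol prescribes the twist of a motion with the linear velocity `-2 b`. -/
theorem exists_twist_eq {x : DQ} (hx : IsUnitDQ x) (h1 : x.fst ≠ -1) {a : ℍ[ℝ]} (b : ℍ[ℝ])
    (ha : a.re = 0) : ∃ ω : ℍ[ℝ], ω.re = 0 ∧
      (-2 : ℝ) • (poseVelocity x a b * conj x) = twist (translation x) ω ((-2 : ℝ) • b) := by
  have hE := fderiv_exp_mul_star_re (logQ_re x.fst) ha
  rw [exp_logQ hx.norm_fst h1] at hE
  set E := fderiv ℝ (NormedSpace.exp : ℍ[ℝ] → ℍ[ℝ]) (logQ x.fst) a with hEdef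
  have hp : star (translation x) = -translation x := by
    rw [Quaternion.star_eq_neg]; exact hx.translation_re
  have hs : star x.snd = -((1 / 2 : ℝ) • (star x.fst * translation x)) := by
    rw [hx.snd_eq]
    simp [hp]
  -- This `ω` is pure because the differential of `exp` is tangent to the sphere. In the dual part,
  -- the term with `p` on the left comes from `poseVelocity` and the one with `p` on the right from
  -- `conj x`; together they form `p × ω`.
  refine ⟨(-2 : ℝ) • (E * star x.fst), by simp [hE], DQ.ext ?_ ?_⟩
  · rw [TrivSqZeroExt.fst_smul, fst_mul, fst_conj, poseVelocity, fst_mkDQ, twist, fst_mkDQ]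
  · rw [TrivSqZeroExt.snd_smul, snd_mul, fst_conj, snd_conj, poseVelocity, fst_mkDQ, snd_mkDQ,
      twist, snd_mkDQ, ← hEdef, hs, cross, add_mul, mul_assoc b,
      mul_star_of_norm_eq_one hx.norm_fst, mul_one]
    simp only [mul_neg, mul_smul_comm, smul_mul_assoc, smul_mul_assoc, ← mul_assoc]
    module

/-- The primary parts identify the angular velocities, so the cross products cancel. The linear
velocity of a trajectory can thus be read off its twist. -/
theorem twist_injective {p ω ω' v v' : ℍ[ℝ]} (h : twist p ω v = twist p ω' v') : v = v' := by
  have h1 := congrArg TrivSqZeroExt.fst h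
  have h2 := congrArg TrivSqZeroExt.snd h
  simp only [twist, fst_mkDQ, snd_mkDQ] at h1 h2
  rw [h1] at h2
  exact add_right_cancel h2

theorem hasDerivWithinAt_poseExp {a b : ℝ → ℍ[ℝ]} {a' b' : ℍ[ℝ]} {s : Set ℝ} {t : ℝ}
    (hre : (a t).re = 0) (hπ : ‖a t‖ < Real.pi) (ha : HasDerivWithinAt a a' s t)
    (hb : HasDerivWithinAt b b' s t) :
    HasDerivWithinAt (fun u => poseExp (a u) (b u)) (poseVelocity (poseExp (a t) (b t)) a' b')
      s t := by
  have h1 : HasDerivWithinAt (fun u => (NormedSpace.exp (a u) : ℍ[ℝ]))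
      (fderiv ℝ (NormedSpace.exp : ℍ[ℝ] → ℍ[ℝ]) (a t) a') s t :=
    (hasStrictFDerivAt_exp (a t)).hasFDerivAt.comp_hasDerivWithinAt t ha
  rw [hasDerivWithinAt_DQ_iff]
  simp only [fst_poseExp, snd_poseExp, poseVelocity, fst_mkDQ, snd_mkDQ, logQ_exp hre hπ,
    translation_poseExp hre]
  refine ⟨h1, (hb.fun_mul h1).congr_deriv ?_⟩
  rw [smul_mul_assoc, smul_smul, add_comm]
  norm_num

end Kinematics

/-! ### Trajectories of the closed loop -/

section ClosedLoop

variable {n : ℕ} {G : WeightedDigraph n}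

/-- Finitely many agents share one bound strictly below `π`; a fixed gap, unlike the individual
strict inequalities, survives limits in time. -/
theorem exists_rotation_bound {x : Fin n → DQ} (hx : Admissible x) :
    ∃ R < Real.pi, ∀ i, ‖logQ (x i).fst‖ ≤ R := by
  have h : ∀ i, ‖logQ (x i).fst‖ < Real.pi := fun i => norm_logQ_lt_pi (hx i).1.norm_fst (hx i).2
  rcases isEmpty_or_nonempty (Fin n) with h0 | h0
  · exact ⟨0, Real.pi_pos, fun i => h0.elim i⟩
  · obtain ⟨i, hi⟩ := Finite.exists_max fun i => ‖logQ (x i).fst‖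
    exact ⟨_, h i, hi⟩

/-- Trajectories of the closed loop in exponential coordinates. -/
theorem isClosedLoop_poseExp {a b : Fin n → ℍ[ℝ]} (ha : ∀ i, (a i).re = 0)
    (hb : ∀ i, (b i).re = 0) (hπ : ∀ i, ‖a i‖ < Real.pi) :
    IsClosedLoop G fun i t => poseExp (∑ j, consensusFlow G.weight t i j • a j)
      (∑ j, consensusFlow G.weight t i j • b j) := by
  set A : Fin n → ℝ → ℍ[ℝ] := fun i t => ∑ j, consensusFlow G.weight t i j • a j with hA
  set B : Fin n → ℝ → ℍ[ℝ] := fun i t => ∑ j, consensusFlow G.weight t i j • b j with hB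
  have hAre : ∀ i t, (A i t).re = 0 := fun i t => re_sum_smul ha
  have hBre : ∀ i t, (B i t).re = 0 := fun i t => re_sum_smul hb
  obtain ⟨R, hR, haR⟩ : ∃ R < Real.pi, ∀ i, ‖a i‖ ≤ R := by
    have := exists_rotation_bound (x := fun i => poseExp (a i) (b i)) fun i =>
      ⟨isUnitDQ_poseExp (ha i) (hb i), fst_poseExp_ne (ha i) (hπ i)⟩
    simpa only [fst_poseExp, logQ_exp (ha _) (hπ _)] using this
  have hAπ : ∀ i t, 0 ≤ t → ‖A i t‖ < Real.pi := fun i t ht =>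
    (norm_sum_consensusFlow_le G.weight_nonneg haR ht i).trans_lt hR
  have hunit : ∀ i t, IsUnitDQ (poseExp (A i t) (B i t)) := fun i t =>
    isUnitDQ_poseExp (hAre i t) (hBre i t)
  have hrot : ∀ i t, 0 ≤ t → rotDisagreement G (fun i => poseExp (A i t) (B i t)) i =
      ∑ j, G.weight i j • (A i t - A j t) := fun i t ht => by
    simp only [rotDisagreement, fst_poseExp, logQ_exp (hAre _ _) (hAπ _ t ht)]
  have htrans : ∀ i t, transDisagreement G (fun i => poseExp (A i t) (B i t)) i =
      ∑ j, G.weight i j • (B i t - B j t) := fun i t => by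
    simp only [transDisagreement, translation_poseExp (hAre _ _), smul_smul]
    norm_num
  refine ⟨fun i => ⟨hunit i 0, fst_poseExp_ne (hAre i 0) (hAπ i 0 le_rfl)⟩,
    fun i t => (-2 : ℝ) • (poseVelocity (poseExp (A i t) (B i t))
      (rotDisagreement G (fun i => poseExp (A i t) (B i t)) i)
      (transDisagreement G (fun i => poseExp (A i t) (B i t)) i) *
        conj (poseExp (A i t) (B i t))), fun i => ⟨⟨fun t _ => hunit i t, fun t ht => ?_,
      fun t ht => ?_⟩, fun t ht => (twistProtocol_eq G i fun i => hunit i t).symm⟩⟩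
  · rw [kinematics_of_unit (hunit i t), ← poseVelocity_neg, hrot i t ht, htrans i t]
    exact hasDerivWithinAt_poseExp (hAre i t) (hAπ i t ht)
      (hasDerivAt_sum_consensusFlow G.weight a t i).hasDerivWithinAt
      (hasDerivAt_sum_consensusFlow G.weight b t i).hasDerivWithinAt
  · obtain ⟨ω, hω, h⟩ := exists_twist_eq (hunit i t) (fst_poseExp_ne (hAre i t) (hAπ i t ht))
      (transDisagreement G (fun i => poseExp (A i t) (B i t)) i)
      (rotDisagreement_re G (fun i => poseExp (A i t) (B i t)) i)
    refine ⟨ω, _, hω, ?_, h⟩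
    have hB2 : (fun s => translation (poseExp (A i s) (B i s))) = fun s => (2 : ℝ) • B i s :=
      funext fun s => translation_poseExp (hAre i s) _
    change HasDerivWithinAt (fun s => translation (poseExp (A i s) (B i s))) _ _ _
    rw [hB2, htrans, neg_smul, ← smul_neg]
    exact (hasDerivAt_sum_consensusFlow G.weight b t i).hasDerivWithinAt.const_smul (2 : ℝ)

theorem exists_closedLoop {x₀ : Fin n → DQ} (hx₀ : Admissible x₀) :
    ∃ x : Fin n → ℝ → DQ, IsClosedLoop G x ∧ (∀ i, x i 0 = x₀ i) := by
  refine ⟨_, isClosedLoop_poseExp (G := G) (fun i => logQ_re (x₀ i).fst)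
    (b := fun i => (1 / 2 : ℝ) • translation (x₀ i))
    (fun i => by simp [(hx₀ i).1.translation_re])
    (fun i => norm_logQ_lt_pi (hx₀ i).1.norm_fst (hx₀ i).2), fun i => ?_⟩
  simp only [consensusFlow_zero, Matrix.one_apply, ite_smul, one_smul, zero_smul,
    Finset.sum_ite_eq, Finset.mem_univ, if_true]
  exact poseExp_log (hx₀ i).1 (hx₀ i).2

variable {x : Fin n → ℝ → DQ}

theorem IsClosedLoop.unit (hx : IsClosedLoop G x) (i : Fin n) {t : ℝ} (ht : 0 ≤ t) :
    IsUnitDQ (x i t) := by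
  obtain ⟨ξ, hξ⟩ := hx.motion
  exact (hξ i).1.unit t ht

theorem IsClosedLoop.continuousOn_fst (hx : IsClosedLoop G x) (i : Fin n) :
    ContinuousOn (fun t => (x i t).fst) (Set.Ici 0) := by
  obtain ⟨ξ, hξ⟩ := hx.motion
  exact fun t ht => (hasDerivWithinAt_DQ_iff.1 ((hξ i).1.kinematics t ht)).1.continuousWithinAt

/-- The logarithms of the poses of the closed loop solve the linear consensus equation. -/
theorem IsClosedLoop.hasDerivWithinAt_log (hx : IsClosedLoop G x) {t : ℝ} (ht : 0 ≤ t)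
    (hadm : Admissible fun i => x i t) (i : Fin n) :
    HasDerivWithinAt (fun s => logQ (x i s).fst)
      (-∑ j, G.weight i j • (logQ (x i t).fst - logQ (x j t).fst)) (Set.Ici 0) t ∧
    HasDerivWithinAt (fun s => (1 / 2 : ℝ) • translation (x i s))
      (-∑ j, G.weight i j • ((1 / 2 : ℝ) • translation (x i t) - (1 / 2 : ℝ) • translation (x j t)))
      (Set.Ici 0) t := by
  obtain ⟨ξ, hξ⟩ := hx.motion
  have hunit : ∀ j, IsUnitDQ (x j t) := fun j => hx.unit j ht
  have hval : ξ i t = (-2 : ℝ) • (poseVelocity (x i t) (rotDisagreement G (fun j => x j t) i)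
      (transDisagreement G (fun j => x j t) i) * conj (x i t)) :=
    vec8_injective (((hξ i).2 t ht).trans (twistProtocol_eq G i hunit))
  constructor
  · have hd := (hξ i).1.kinematics t ht
    rw [hval, kinematics_of_unit (hunit i), ← poseVelocity_neg] at hd
    have h1 := (hasDerivWithinAt_DQ_iff.1 hd).1
    rw [poseVelocity, fst_mkDQ] at h1
    exact hasDerivWithinAt_logQ (r := fun s => (x i s).fst) ht
      (fun a ha => (hx.unit i ha).norm_fst) (hadm i).2
      (by rw [Quaternion.re_neg, neg_eq_zero]; exact rotDisagreement_re G (fun j => x j t) i) h1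
  · obtain ⟨ω, v, -, hv, hξv⟩ := (hξ i).1.isTwist t ht
    obtain ⟨ω', -, hω'⟩ := exists_twist_eq (hunit i) (hadm i).2
      (transDisagreement G (fun j => x j t) i) (rotDisagreement_re G (fun j => x j t) i)
    rw [hval, hω'] at hξv
    rw [← twist_injective hξv] at hv
    refine (hv.const_smul (1 / 2 : ℝ)).congr_deriv ?_
    rw [smul_smul, transDisagreement]
    norm_num

/-- As long as the closed loop is admissible, it is given by the consensus flow. -/
theorem IsClosedLoop.log_eq (hx : IsClosedLoop G x) {t : ℝ} (ht : 0 ≤ t)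
    (hadm : ∀ s ∈ Set.Icc 0 t, Admissible fun i => x i s) (i : Fin n) :
    logQ (x i t).fst = ∑ j, consensusFlow G.weight t i j • logQ (x j 0).fst ∧
    (1 / 2 : ℝ) • translation (x i t) =
      ∑ j, consensusFlow G.weight t i j • (1 / 2 : ℝ) • translation (x j 0) :=
  ⟨eq_sum_consensusFlow G.weight (y := fun i s => logQ (x i s).fst) ht
    (fun i s hs => (hx.hasDerivWithinAt_log hs.1 (hadm s hs) i).1) i,
  eq_sum_consensusFlow G.weight (y := fun i s => (1 / 2 : ℝ) • translation (x i s)) ht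
    (fun i s hs => (hx.hasDerivWithinAt_log hs.1 (hadm s hs) i).2) i⟩

/-- Admissibility is preserved along the closed loop. -/
theorem IsClosedLoop.admissible (hx : IsClosedLoop G x) {t : ℝ} (ht : 0 ≤ t) :
    Admissible fun i => x i t := by
  refine fun i => ⟨hx.unit i ht, fun hbad => ?_⟩
  -- The times at which some rotation equals `-1` form a closed set; its infimum `τ` is the first
  -- such time, and the linear equation is available before `τ`.
  set S : Set ℝ := ⋃ i, Set.Ici 0 ∩ (fun s => (x i s).fst) ⁻¹' {-1} with hS
  have hSc : IsClosed S := isClosed_iUnion_of_finite fun i =>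
    (hx.continuousOn_fst i).preimage_isClosed_of_isClosed isClosed_Ici isClosed_singleton
  have hSne : S.Nonempty := ⟨t, Set.mem_iUnion.2 ⟨i, ht, hbad⟩⟩
  have hSbdd : BddBelow S := ⟨0, fun s hs => by
    obtain ⟨j, hj⟩ := Set.mem_iUnion.1 hs
    exact hj.1⟩
  obtain ⟨k, hk0, hk⟩ := Set.mem_iUnion.1 (hSc.csInf_mem hSne hSbdd)
  set τ := sInf S
  have hk1 : (x k τ).fst = -1 := hk
  have hτ0 : 0 ≤ τ := hk0
  have hτ : 0 < τ := lt_of_le_of_ne hτ0 fun h => (hx.init k).2 (by rw [h]; exact hk1)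
  have hadm : ∀ s, 0 ≤ s → s < τ → Admissible fun i => x i s := fun s hs hsτ j =>
    ⟨hx.unit j hs, fun h => (csInf_le hSbdd (Set.mem_iUnion.2 ⟨j, hs, h⟩)).not_gt hsτ⟩
  obtain ⟨R, hR, hbound⟩ := exists_rotation_bound hx.init
  -- Before `τ` the real part stays above `cos R > -1`. By continuity it does so at `τ` as well,
  -- where it should be `-1`; the protocol at `τ` plays no role.
  have hre : ∀ s, 0 ≤ s → s < τ → Real.cos R ≤ (x k s).fst.re := by
    intro s hs hsτ
    have hle : ‖logQ (x k s).fst‖ ≤ R := by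
      rw [(hx.log_eq hs (fun u hu => hadm u hu.1 (hu.2.trans_lt hsτ)) k).1]
      exact norm_sum_consensusFlow_le G.weight_nonneg hbound hs k
    rw [← exp_logQ (hx.unit k hs).norm_fst (hadm s hs hsτ k).2,
      re_exp_of_re_eq_zero (logQ_re _)]
    exact Real.cos_le_cos_of_nonneg_of_le_pi (norm_nonneg _) hR.le hle
  have hlim : Tendsto (fun s => (x k s).fst.re) (𝓝[Set.Ico 0 τ] τ) (𝓝 (x k τ).fst.re) :=
    Quaternion.continuous_re.continuousAt.tendsto.comp
      ((hx.continuousOn_fst k τ hτ0).mono Set.Ico_subset_Ici_self)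
  have hne : (𝓝[Set.Ico 0 τ] τ).NeBot := by
    rw [← mem_closure_iff_nhdsWithin_neBot, closure_Ico hτ.ne]
    exact ⟨hτ0, le_rfl⟩
  have hle : Real.cos R ≤ (x k τ).fst.re := ge_of_tendsto hlim (by
    filter_upwards [self_mem_nhdsWithin] with s hs using hre s hs.1 hs.2)
  have hR0 : 0 ≤ R := (norm_nonneg _).trans (hbound k)
  have hcos := Real.cos_lt_cos_of_nonneg_of_le_pi hR0 le_rfl hR
  rw [hk1] at hle
  simp only [Quaternion.re_neg, Quaternion.re_one, Real.cos_pi] at hle hcos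
  linarith

theorem tendsto_sum_smul {V : Type*} [NormedAddCommGroup V] [NormedSpace ℝ V]
    {ν : Fin n → ℝ} (hν : ∀ i j, Tendsto (fun t => consensusFlow G.weight t i j) atTop (𝓝 (ν j)))
    (y : Fin n → V) (i : Fin n) :
    Tendsto (fun t => ∑ j, consensusFlow G.weight t i j • y j) atTop (𝓝 (∑ j, ν j • y j)) :=
  tendsto_finsetSum _ fun j _ => (hν i j).smul_const (y j)

/-- With a directed spanning tree, the logarithms converge to a common pair of pure quaternions. -/
theorem IsClosedLoop.exists_tendsto_log (hx : IsClosedLoop G x)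
    (hG : HasDirectedSpanningTree G.toDigraph) : ∃ a b : ℍ[ℝ], a.re = 0 ∧ b.re = 0 ∧ ∀ i,
      Tendsto (fun t => logQ (x i t).fst) atTop (𝓝 a) ∧
      Tendsto (fun t => (1 / 2 : ℝ) • translation (x i t)) atTop (𝓝 b) := by
  obtain ⟨ν, hν⟩ := G.exists_tendsto_flow hG
  refine ⟨∑ j, ν j • logQ (x j 0).fst, ∑ j, ν j • (1 / 2 : ℝ) • translation (x j 0),
    re_sum_smul fun j => logQ_re _, re_sum_smul fun j => by simp [(hx.unit j le_rfl).translation_re],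
    fun i => ⟨?_, ?_⟩⟩
  · refine (tendsto_sum_smul hν _ i).congr' ?_
    filter_upwards [eventually_ge_atTop 0] with t ht
    exact (hx.log_eq ht (fun s hs => hx.admissible hs.1) i).1.symm
  · refine (tendsto_sum_smul hν _ i).congr' ?_
    filter_upwards [eventually_ge_atTop 0] with t ht
    exact (hx.log_eq ht (fun s hs => hx.admissible hs.1) i).2.symm

theorem IsClosedLoop.achievesOutputConsensus (hx : IsClosedLoop G x)
    (hG : HasDirectedSpanningTree G.toDigraph) : AchievesOutputConsensus x := by
  obtain ⟨a, b, -, -, h⟩ := hx.exists_tendsto_log hG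
  have hl : ∀ i, Tendsto (fun t => logDQ (x i t)) atTop (𝓝 (mkDQ a b)) := fun i => by
    simp only [logDQ_eq]
    exact (continuous_mkDQ.tendsto (a, b)).comp ((h i).1.prodMk_nhds (h i).2)
  intro i j
  simpa using (hl i).sub (hl j)

theorem IsClosedLoop.achievesPoseConsensus (hx : IsClosedLoop G x)
    (hG : HasDirectedSpanningTree G.toDigraph) : AchievesPoseConsensus x := by
  obtain ⟨a, b, ha, hb, h⟩ := hx.exists_tendsto_log hG
  refine ⟨poseExp a b, isUnitDQ_poseExp ha hb, fun i => ?_⟩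
  refine ((continuous_poseExp.tendsto (a, b)).comp ((h i).1.prodMk_nhds (h i).2)).congr' ?_
  filter_upwards [eventually_ge_atTop 0] with t ht
  exact poseExp_log (hx.unit i ht) (hx.admissible ht i).2

/-- Without a directed spanning tree, two agents can rest at distinct poses forever. -/
theorem exists_closedLoop_gap (hn : 0 < n) (hG : ¬ HasDirectedSpanningTree G.toDigraph) :
    ∃ (x : Fin n → ℝ → DQ) (i j : Fin n) (u : ℍ[ℝ]), IsClosedLoop G x ∧ u ≠ 0 ∧
      ∀ t, 0 ≤ t → x i t = poseExp 0 u ∧ x j t = poseExp 0 0 := by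
  obtain ⟨z, i, j, h⟩ := G.exists_constant_gap hn hG
  let u : ℍ[ℝ] := ⟨0, 1, 0, 0⟩
  have hu : u ≠ 0 := fun h => by simpa [u] using congrArg (fun q : ℍ[ℝ] => q.imI) h
  have hu0 : u.re = 0 := rfl
  -- All rotations are the identity, and the translations lie along the single direction `u` with
  -- the scalar values `z`.
  refine ⟨_, i, j, u, isClosedLoop_poseExp (G := G) (a := fun _ => 0) (b := fun k => z k • u)
    (fun _ => rfl) (fun k => by simp [hu0]) (fun _ => by simpa using Real.pi_pos), hu,
    fun t ht => ?_⟩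
  simp only [smul_zero, Finset.sum_const_zero, smul_smul, ← Finset.sum_smul, (h t ht).1,
    (h t ht).2, one_smul, zero_smul, and_self]

end ClosedLoop

end PoseConsensus

end

/-! ### The consensus theorem -/

theorem mainTheorem8 (n : ℕ) (hn : 0 < n) (G : PoseConsensus.WeightedDigraph n) :
    (∀ x₀ : Fin n → PoseConsensus.DQ, PoseConsensus.Admissible x₀ →
      ∃ x : Fin n → ℝ → PoseConsensus.DQ, PoseConsensus.IsClosedLoop G x ∧
        (∀ i, x i 0 = x₀ i) ∧ ∀ t, 0 ≤ t → PoseConsensus.Admissible fun i => x i t) ∧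
    (PoseConsensus.HasDirectedSpanningTree G.toDigraph ↔
      ∀ x : Fin n → ℝ → PoseConsensus.DQ, PoseConsensus.IsClosedLoop G x →
        PoseConsensus.AchievesOutputConsensus x) ∧
    (PoseConsensus.HasDirectedSpanningTree G.toDigraph ↔
      ∀ x : Fin n → ℝ → PoseConsensus.DQ, PoseConsensus.IsClosedLoop G x →
        PoseConsensus.AchievesPoseConsensus x) := by
  open PoseConsensus in
  refine ⟨fun x₀ hx₀ => ?_, ⟨fun hG x hx => hx.achievesOutputConsensus hG, fun h => ?_⟩,
    ⟨fun hG x hx => hx.achievesPoseConsensus hG, fun h => ?_⟩⟩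
  · obtain ⟨x, hx, h0⟩ := exists_closedLoop (G := G) hx₀
    exact ⟨x, hx, h0, fun t ht => hx.admissible ht⟩
  · by_contra hG
    obtain ⟨x, i, j, u, hx, hu, hgap⟩ := exists_closedLoop_gap hn hG
    have h1 : Tendsto (fun t => logDQ (x i t) - logDQ (x j t)) atTop
        (𝓝 (mkDQ 0 u - mkDQ 0 0)) := by
      refine tendsto_const_nhds.congr' ?_
      filter_upwards [eventually_ge_atTop 0] with t ht
      have h0 : ‖(0 : ℍ[ℝ])‖ < Real.pi := by simpa using Real.pi_pos
      rw [(hgap t ht).1, (hgap t ht).2, logDQ_poseExp rfl h0, logDQ_poseExp rfl h0]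
    have h2 := congrArg TrivSqZeroExt.snd (tendsto_nhds_unique h1 (h x hx i j))
    rw [TrivSqZeroExt.snd_sub, snd_mkDQ, snd_mkDQ, sub_zero] at h2
    exact hu h2
  · by_contra hG
    obtain ⟨x, i, j, u, hx, hu, hgap⟩ := exists_closedLoop_gap hn hG
    obtain ⟨c, -, hc⟩ := h x hx
    have h1 : poseExp 0 u = c := tendsto_nhds_unique (tendsto_const_nhds.congr' (by
      filter_upwards [eventually_ge_atTop 0] with t ht using (hgap t ht).1.symm)) (hc i)
    have h2 : poseExp 0 0 = c := tendsto_nhds_unique (tendsto_const_nhds.congr' (by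
      filter_upwards [eventually_ge_atTop 0] with t ht using (hgap t ht).2.symm)) (hc j)
    have h3 := congrArg TrivSqZeroExt.snd (h1.trans h2.symm)
    rw [snd_poseExp, snd_poseExp, NormedSpace.exp_zero, mul_one, zero_mul] at h3
    exact hu h3
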